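/- Let $M$ be a smooth (Hausdorff, finite-dimensional, real) manifold and $E\to M$ a smooth real vector bundle of finite rank. The gauge Lie algebroid $\mathfrak{D}E\to M$ has as fibre over $m$ the space of $\mathbb{R}$-linear operators $\mathfrak d:\Gamma(E)\to E_m$ together with a vector $x=\alpha(\mathfrak d)\in T_mM$, the anchor, such that $\mathfrak d(fu)=f(m)\,\mathfrak d(u)+x(f)\,u(m)$ for all $f\in C^\infty(M)$, $u\in\Gamma(E)$; its bracket $[\cdot,\cdot]_{\mathfrak D}$ on $\Gamma(\mathfrak{D}E)$ is the commutator of operators on $\Gamma(E)$, with anchor the commutator of the vector fields. Its standard $E$-dual (isomorphic to the first jet bundle of $E$) is $$\mathfrak{J}E=\{\nu\in\mathrm{Hom}(\mathfrak{D}E,E)\mid \nu(\Phi)=\Phi(\nu(\mathbf 1_E))\ \ \forall\,\Phi\in\mathfrak{gl}(E)\},$$ with the $E$-valued pairing $\langle\mu,\mathfrak d\rangle_E=\langle\mathfrak d,\mu\rangle_E=\mu(\mathfrak d)$. For $u\in\Gamma(E)$ let $\mathbb{d}u\in\Gamma(\mathfrak{J}E)$ be given by $\langle\mathbb{d}u,\mathfrak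 d\rangle_E=\mathfrak d u$, and for $\mathfrak d\in\Gamma(\mathfrak{D}E)$, $\mu\in\Gamma(\mathfrak{J}E)$ let $\mathfrak L_{\mathfrak d}\mu\in\Gamma(\mathfrak{J}E)$ be given by $\langle\mathfrak L_{\mathfrak d}\mu,\mathfrak d'\rangle_E=\mathfrak d\langle\mu,\mathfrak d'\rangle_E-\langle\mu,[\mathfrak d,\mathfrak d']_{\mathfrak D}\rangle_E$ for all $\mathfrak d'\in\Gamma(\mathfrak{D}E)$. The omni-Lie algebroid is $\mathcal E=\mathfrak{D}E\oplus\mathfrak{J}E$ with the projection $\rho:\mathcal E\to\mathfrak{D}E$, the symmetric $E$-valued form $$(\mathfrak d+\mu,\mathfrak r+\nu)_E=\tfrac12\big(\langle\mathfrak d,\nu\rangle_E+\langle\mathfrak r,\mu\rangle_E\big)$$ and the Dorfman bracket on $\Gamma(\mathcal E)$ $$\{\mathfrak d+\mu,\mathfrak r+\nu\}=[\mathfrak d,\mathfrak r]_{\mathfrak D}+\mathfrak L_{\mathfrak d}\nu-\mathfrak L_{\mathfrak r}\mu+\mathbb{d}\langle\mu,\mathfrak r\rangle_E .$$ A Dirac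 structure is a smooth subbundle $L\subset\mathcal E$ each of whose fibres $L_m$ is a maximal isotropic subspace of $\mathcal E_m$ for $(\cdot,\cdot)_E$, and whose space of smooth sections $\Gamma(L)$ is closed under $\{\cdot,\cdot\}$. **Proposition.** Let $L\subset\mathcal E$ be a Dirac structure. Then $L$, with the restriction of $\{\cdot,\cdot\}$ to $\Gamma(L)$ and the anchor $a=\alpha\circ\rho|_L:L\to TM$, is a Lie algebroid: the bracket is $\mathbb{R}$-bilinear, alternating and satisfies the Jacobi identity, $a$ is a smooth bundle map, $\{X,fY\}=f\{X,Y\}+a(X)(f)\,Y$ and $a\{X,Y\}=[a(X),a(Y)]$ for all $X,Y\in\Gamma(L)$, $f\in C^\infty(M)$. Moreover, $\rho|_L:L\to\mathfrak{D}E$ is a representation of $L$ on $E$, that is, a morphism of Lie algebroids over $\mathrm{id}_M$: a smooth bundle map with $\alpha\circ\rho|_L=a$ and $\rho\{X,Y\}=[\rho X,\rho Y]_{\mathfrak D}$ for all $X,Y\in\Gamma(L)$. -/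

import Mathlib

open Bundle Topology
open scoped Manifold ContDiff

noncomputable section

namespace OmniLie

/-- Smooth real-valued functions on `M`. -/
abbrev SmoothFun (n : ℕ) (M : Type*) [TopologicalSpace M]
    [ChartedSpace (EuclideanSpace ℝ (Fin n)) M] : Type _ := C^∞⟮𝓡 n, M; ℝ⟯

/-- Smooth vector fields on `M`. -/
abbrev VecField (n : ℕ) (M : Type*) [TopologicalSpace M]
    [ChartedSpace (EuclideanSpace ℝ (Fin n)) M] [IsManifold (𝓡 n) ∞ M] : Type _ :=
  Cₛ^∞⟮𝓡 n; EuclideanSpace ℝ (Fin n), (TangentSpace (𝓡 n) : M → Type _)⟯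

/-- The space `Γ(E)` of smooth global sections of a vector bundle `E → M` with model fibre `F`. -/
abbrev Sec (n : ℕ) {M : Type*} [TopologicalSpace M] [ChartedSpace (EuclideanSpace ℝ (Fin n)) M]
    (F : Type*) [NormedAddCommGroup F] [NormedSpace ℝ F] (E : M → Type*)
    [TopologicalSpace (TotalSpace F E)] [∀ m, AddCommGroup (E m)] [∀ m, Module ℝ (E m)]
    [∀ m, TopologicalSpace (E m)] [FiberBundle F E] [VectorBundle ℝ F E] : Type _ :=
  Cₛ^∞⟮𝓡 n; F, E⟯

section Basic

variable {n : ℕ} {M : Type*} [TopologicalSpace M] [ChartedSpace (EuclideanSpace ℝ (Fin n)) M]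

/-- The derivative `x(f)` of a smooth function along a tangent vector `x ∈ T_m M`. -/
def dirDeriv {m : M} (x : TangentSpace (𝓡 n) m) (f : SmoothFun n M) : ℝ :=
  mvfderiv (𝓡 n) f m x

lemma dirDeriv_add_left {m : M} (x y : TangentSpace (𝓡 n) m) (f : SmoothFun n M) :
    dirDeriv (x + y) f = dirDeriv x f + dirDeriv y f := map_add _ _ _

lemma dirDeriv_smul_left {m : M} (c : ℝ) (x : TangentSpace (𝓡 n) m) (f : SmoothFun n M) :
    dirDeriv (c • x) f = c * dirDeriv x f := map_smul _ _ _

lemma dirDeriv_zero_left {m : M} (f : SmoothFun n M) :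
    dirDeriv (0 : TangentSpace (𝓡 n) m) f = 0 := map_zero _

lemma SmoothFun.mdiff (f : SmoothFun n M) (m : M) :
    MDifferentiableAt (𝓡 n) 𝓘(ℝ, ℝ) f m := f.contMDiff.mdifferentiable (by simp) m

lemma dirDeriv_add {m : M} (x : TangentSpace (𝓡 n) m) (f g : SmoothFun n M) :
    dirDeriv x (f + g) = dirDeriv x f + dirDeriv x g := by
  simp [dirDeriv, ContMDiffMap.coe_add, mvfderiv_add (f.mdiff m) (g.mdiff m)]

lemma dirDeriv_const_smul {m : M} (x : TangentSpace (𝓡 n) m) (c : ℝ) (f : SmoothFun n M) :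
    dirDeriv x (c • f) = c * dirDeriv x f := by
  have h : (⇑(c • f) : M → ℝ) = (fun _ => c) * ⇑f := by ext p; simp
  have := mvfderiv_mul (I := 𝓡 n) (mdifferentiableAt_const (c := c) (x := m)) (f.mdiff m)
  simp [dirDeriv, h, this, mvfderiv_const]

lemma dirDeriv_mul {m : M} (x : TangentSpace (𝓡 n) m) (f g : SmoothFun n M) :
    dirDeriv x (f * g) = f m * dirDeriv x g + g m * dirDeriv x f := by
  have := mvfderiv_mul (I := 𝓡 n) (f.mdiff m) (g.mdiff m)
  simp [dirDeriv, this]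

lemma dirDeriv_one {m : M} (x : TangentSpace (𝓡 n) m) :
    dirDeriv x (1 : SmoothFun n M) = 0 := by
  have := dirDeriv_mul x (1 : SmoothFun n M) 1
  simp only [mul_one, ContMDiffMap.coe_one, Pi.one_apply, one_mul] at this
  linarith

lemma dirDeriv_sum_left {ι : Type*} (t : Finset ι) {m : M} (x : ι → TangentSpace (𝓡 n) m)
    (f : SmoothFun n M) : dirDeriv (∑ i ∈ t, x i) f = ∑ i ∈ t, dirDeriv (x i) f :=
  map_sum (mvfderiv (𝓡 n) f m) _ _

lemma dirDeriv_congr {m : M} (x : TangentSpace (𝓡 n) m) {f g : SmoothFun n M}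
    (h : ∀ᶠ p in 𝓝 m, f p = g p) : dirDeriv x f = dirDeriv x g := by
  have : (f : M → ℝ) =ᶠ[𝓝 m] g := h
  simp only [dirDeriv, mvfderiv, this.mfderiv_eq]
  rfl

/-- The function `x(f)` for a smooth vector field `x`. -/
def VecField.app [IsManifold (𝓡 n) ∞ M] (x : VecField n M) (f : SmoothFun n M) :
    SmoothFun n M where
  val p := dirDeriv (x p) f
  property := by
    have h1 := f.contMDiff.contMDiff_tangentMap (m := ∞) (by simp)
    have h2 := (contMDiff_snd_tangentBundle_modelSpace ℝ 𝓘(ℝ, ℝ) (n := ∞)).comp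
      (h1.comp x.contMDiff)
    exact h2

@[simp] lemma VecField.app_apply [IsManifold (𝓡 n) ∞ M] (x : VecField n M) (f : SmoothFun n M)
    (p : M) : x.app f p = dirDeriv (x p) f := rfl

/-- The commutator of smooth vector fields. -/
def VecField.bracket [IsManifold (𝓡 n) ∞ M] (x y : VecField n M) : VecField n M where
  toFun := VectorField.mlieBracket (𝓡 n) x y
  contMDiff_toFun := by
    have : IsManifold (𝓡 n) (minSmoothness ℝ 2) M := by
      rw [minSmoothness_of_isRCLikeNormedField]; infer_instance
    have : IsManifold (𝓡 n) (((⊤ : ℕ∞) : WithTop ℕ∞) + 1) M := by simpa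
    exact ContDiff.mlieBracket_vectorField (m := ⊤) (n := ⊤)
      x.contMDiff y.contMDiff (by simp)

variable {F : Type*} [NormedAddCommGroup F] [NormedSpace ℝ F] {E : M → Type*}
    [TopologicalSpace (TotalSpace F E)] [∀ m, AddCommGroup (E m)] [∀ m, Module ℝ (E m)]
    [∀ m, TopologicalSpace (E m)] [FiberBundle F E] [VectorBundle ℝ F E]

/-- The product `f u` of a smooth function and a smooth section. -/
def fsmul (f : SmoothFun n M) (u : Sec n F E) : Sec n F E where
  toFun p := f p • u p
  contMDiff_toFun := f.contMDiff.smul_section u.contMDiff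

@[simp] lemma fsmul_apply (f : SmoothFun n M) (u : Sec n F E) (p : M) :
    fsmul f u p = f p • u p := rfl

lemma sec_sum_apply {ι : Type*} (t : Finset ι) (g : ι → Sec n F E) (p : M) :
    (∑ i ∈ t, g i) p = ∑ i ∈ t, g i p := by
  have := map_sum (ContMDiffSection.coeAddHom (𝓡 n) F ∞ E) g t
  exact (congrFun this p).trans (Finset.sum_apply _ _ _)

variable [ContMDiffVectorBundle ∞ F E (𝓡 n)]

lemma exists_localFrame [FiniteDimensional ℝ F] [T2Space M] [IsManifold (𝓡 n) ∞ M] (m : M) :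
    ∃ (k : ℕ) (s : Fin k → Sec n F E) (c : Fin k → Sec n F E →ₗ[ℝ] SmoothFun n M)
      (ψ : SmoothFun n M), (∀ᶠ p in 𝓝 m, ψ p = 1) ∧
      (∀ j f u, c j (fsmul f u) = f * c j u) ∧ (∀ j u p, u p = 0 → c j u p = 0) ∧
      (∀ u, ∑ j, fsmul (c j u) (s j) = fsmul ψ u) := by
  let e := trivializationAt F E m
  have hm : e.baseSet ∈ 𝓝 m :=
    e.open_baseSet.mem_nhds (FiberBundle.mem_baseSet_trivializationAt F E m)
  obtain ⟨χ, -, hχ⟩ := (SmoothBumpFunction.nhds_basis_tsupport (I := 𝓡 n) m).mem_iff.1 hm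
  let b := Module.finBasis ℝ F
  have : ContMDiffVectorBundle 1 F E (𝓡 n) := ContMDiffVectorBundle.of_le (n := ∞) (by simp)
  let s : Fin (Module.finrank ℝ F) → Sec n F E := fun j =>
    ⟨(χ : M → ℝ) • e.localFrame b j, ContMDiffOn.smul_section_of_tsupport
      χ.contMDiff.contMDiffOn e.open_baseSet hχ (e.contMDiffOn_localFrame_baseSet _ b j)⟩
  have hc : ∀ (j) (u : Sec n F E), ContMDiff (𝓡 n) 𝓘(ℝ, ℝ) ∞
      (fun p => χ p * e.localFrameCoeff (𝓡 n) b j p (u p)) := by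
    intro j u
    refine contMDiff_of_tsupport fun p hp => ?_
    have hp' : p ∈ e.baseSet := hχ (tsupport_mul_subset_left hp)
    exact χ.contMDiff.contMDiffAt.mul
      (contMDiffAt_localFrameCoeff b hp' u.contMDiff.contMDiffAt j)
  let c : Fin (Module.finrank ℝ F) → Sec n F E →ₗ[ℝ] SmoothFun n M := fun j =>
    { toFun := fun u => ⟨fun p => χ p * e.localFrameCoeff (𝓡 n) b j p (u p), hc j u⟩
      map_add' := fun u v => by
        ext p
        change χ p * e.localFrameCoeff (𝓡 n) b j p (u p + v p) = _ * _ + _ * _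
        rw [map_add, mul_add]
      map_smul' := fun r u => by
        ext p
        change χ p * e.localFrameCoeff (𝓡 n) b j p (r • u p) = r * (_ * _)
        rw [map_smul, smul_eq_mul]; ring }
  refine ⟨_, s, c, ⟨fun p => χ p * χ p, χ.contMDiff.mul χ.contMDiff⟩, ?_, ?_, ?_, ?_⟩
  · filter_upwards [χ.eventuallyEq_one] with p hp
    simp [hp]
  · intro j f u
    ext p
    change χ p * e.localFrameCoeff (𝓡 n) b j p (f p • u p) = f p * (_ * _)
    rw [map_smul, smul_eq_mul]; ring
  · intro j u p hu
    change χ p * e.localFrameCoeff (𝓡 n) b j p (u p) = 0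
    rw [hu, map_zero, mul_zero]
  · intro u
    ext p
    rw [sec_sum_apply]
    change ∑ j, (χ p * e.localFrameCoeff (𝓡 n) b j p (u p)) • (χ p • e.localFrame b j p)
      = (χ p * χ p) • u p
    by_cases hp : p ∈ e.baseSet
    · conv_rhs => rw [e.eq_sum_localFrameCoeff_smul (s := u) (I := 𝓡 n) (b := b) hp]
      rw [Finset.smul_sum]
      refine Finset.sum_congr rfl fun j _ => ?_
      simp only [smul_smul]
      congr 1
      ring
    · have : χ p = 0 := image_eq_zero_of_notMem_tsupport fun h => hp (hχ h)
      simp [this]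

lemma exists_section_apply_eq [FiniteDimensional ℝ F] [T2Space M] [IsManifold (𝓡 n) ∞ M]
    (m : M) (v : E m) : ∃ u : Sec n F E, u m = v := by
  obtain ⟨t, ht, hs⟩ := FiberBundle.exists_contMDiffOn_extend (𝓡 n) (k := ∞) F v
  obtain ⟨χ, -, hχ⟩ :=
    (SmoothBumpFunction.nhds_basis_tsupport (I := 𝓡 n) m).mem_iff.1 (interior_mem_nhds.2 ht)
  refine ⟨⟨(χ : M → ℝ) • FiberBundle.extend F v, ContMDiffOn.smul_section_of_tsupport
      χ.contMDiff.contMDiffOn isOpen_interior hχ (hs.mono interior_subset)⟩, ?_⟩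
  change χ m • FiberBundle.extend F v m = v
  simp

lemma VecField.mdiff [IsManifold (𝓡 n) ∞ M] (z : VecField n M) (p : M) :
    MDifferentiableAt (𝓡 n) (𝓡 n).tangent (fun p => (⟨p, z p⟩ : TangentBundle (𝓡 n) M)) p :=
  z.contMDiff.mdifferentiable (by simp) p

lemma VecField.bracket_fsmul [IsManifold (𝓡 n) ∞ M] (u v : VecField n M) (g : SmoothFun n M) :
    u.bracket (fsmul g v) = fsmul (u.app g) v + fsmul g (u.bracket v) := by
  ext p
  exact VectorField.mlieBracket_smul_right (g.mdiff p) (v.mdiff p)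

lemma VecField.bracket_add [IsManifold (𝓡 n) ∞ M] (u v w : VecField n M) :
    u.bracket (v + w) = u.bracket v + u.bracket w := by
  have : IsManifold (𝓡 n) (minSmoothness ℝ 2) M := by
    rw [minSmoothness_of_isRCLikeNormedField]; infer_instance
  ext p
  exact VectorField.mlieBracket_add_right (v.mdiff p) (w.mdiff p)

lemma VecField.bracket_const_smul [IsManifold (𝓡 n) ∞ M] (u v : VecField n M) (r : ℝ) :
    u.bracket (r • v) = r • u.bracket v := by
  have : IsManifold (𝓡 n) (minSmoothness ℝ 2) M := by
    rw [minSmoothness_of_isRCLikeNormedField]; infer_instance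
  ext p
  exact VectorField.mlieBracket_const_smul_right (v.mdiff p)

lemma VecField.bracket_zero [IsManifold (𝓡 n) ∞ M] (u : VecField n M) :
    u.bracket 0 = 0 := by
  have h := VecField.bracket_const_smul u 0 (0 : ℝ)
  rwa [zero_smul, zero_smul] at h

/-- The commutator of vector fields is the commutator of derivations. -/
lemma dirDeriv_bracket [T2Space M] [IsManifold (𝓡 n) ∞ M] (x y : VecField n M) (f : SmoothFun n M) (m : M) :
    dirDeriv (x.bracket y m) f = dirDeriv (x m) (y.app f) - dirDeriv (y m) (x.app f) := by
  have : IsManifold (𝓡 n) (minSmoothness ℝ 3) M := by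
    rw [minSmoothness_of_isRCLikeNormedField]; infer_instance
  have : IsManifold (𝓡 n) (minSmoothness ℝ 2) M := by
    rw [minSmoothness_of_isRCLikeNormedField]; infer_instance
  have cd : ∀ z : VecField n M, ContMDiff (𝓡 n) (𝓡 n).tangent (minSmoothness ℝ 2)
      (fun p => (⟨p, z p⟩ : TangentBundle (𝓡 n) M)) := fun z => by
    rw [minSmoothness_of_isRCLikeNormedField]; exact z.contMDiff.of_le ENat.LEInfty.out
  have L := fun (u v : VecField n M) (g : SmoothFun n M) => VecField.bracket_fsmul u v g
  have J : ∀ u v w : VecField n M,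
      u.bracket (v.bracket w) = (u.bracket v).bracket w + v.bracket (u.bracket w) := by
    intro u v w
    ext p
    exact VectorField.leibniz_identity_mlieBracket_apply (cd u p) (cd v p) (cd w p)
  have A := fun u v w : VecField n M => VecField.bracket_add u v w
  by_cases hs : Subsingleton (TangentSpace (𝓡 n) m)
  · rw [Subsingleton.elim (x.bracket y m) 0, Subsingleton.elim (x m) 0, Subsingleton.elim (y m) 0]
    simp [dirDeriv_zero_left]
  rw [not_subsingleton_iff_nontrivial] at hs
  obtain ⟨v, hv⟩ := exists_ne (0 : TangentSpace (𝓡 n) m)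
  obtain ⟨z, hz⟩ := exists_section_apply_eq (n := n) (F := EuclideanSpace ℝ (Fin n)) m v
  have key := congrArg (fun u : VecField n M => u m) (J x y (fsmul f z))
  simp only [L, A] at key
  have key2 := congrArg (fun u : VecField n M => u m) (J x y z)
  simp only [ContMDiffSection.coe_add, Pi.add_apply, fsmul_apply, VecField.app_apply] at key key2
  rw [key2] at key
  have : (dirDeriv (x m) (y.app f) - dirDeriv (y m) (x.app f) - dirDeriv (x.bracket y m) f) • z m
      = 0 := by
    simp only [sub_smul]
    rw [← sub_eq_zero.2 key]
    module
  rw [hz] at this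
  have := (smul_eq_zero.1 this).resolve_right hv
  linarith

end Basic

section Gauge

variable (n : ℕ) {M : Type*} [TopologicalSpace M] [ChartedSpace (EuclideanSpace ℝ (Fin n)) M]
    (F : Type*) [NormedAddCommGroup F] [NormedSpace ℝ F] (E : M → Type*)
    [TopologicalSpace (TotalSpace F E)] [∀ m, AddCommGroup (E m)] [∀ m, Module ℝ (E m)]
    [∀ m, TopologicalSpace (E m)] [FiberBundle F E] [VectorBundle ℝ F E]

/-- Pairs of an `ℝ`-linear operator `δ : Γ(E) → E_m` and a tangent vector `x ∈ T_m M` with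
`δ (f u) = f(m) δ(u) + x(f) u(m)`. -/
def gaugeSubmodule (m : M) : Submodule ℝ ((Sec n F E →ₗ[ℝ] E m) × TangentSpace (𝓡 n) m) where
  carrier := {d | ∀ (f : SmoothFun n M) (u : Sec n F E),
    d.1 (fsmul f u) = f m • d.1 u + dirDeriv d.2 f • u m}
  zero_mem' f u := by simp [dirDeriv_zero_left]
  add_mem' {a b} ha hb f u := by
    simp only [Set.mem_ofPred_eq] at ha hb
    simp only [Prod.fst_add, Prod.snd_add, LinearMap.add_apply, ha f u, hb f u, dirDeriv_add_left]
    module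
  smul_mem' r a ha f u := by
    simp only [Set.mem_ofPred_eq] at ha
    simp only [Prod.smul_fst, Prod.smul_snd, LinearMap.smul_apply, ha f u, dirDeriv_smul_left]
    module

/-- The fibre `(𝔇E)_m` of the gauge Lie algebroid (the bundle of covariant differential operators)
of `E`: operators `𝔡 : Γ(E) → E_m` together with their anchor `x ∈ T_m M`. -/
def GaugeFiber (m : M) : Type _ := gaugeSubmodule n F E m

instance instAddCommGroupGaugeFiber (m : M) : AddCommGroup (GaugeFiber n F E m) :=
  (gaugeSubmodule n F E m).addCommGroup

instance instModuleGaugeFiber (m : M) : Module ℝ (GaugeFiber n F E m) :=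
  (gaugeSubmodule n F E m).module

variable {n F E}

/-- The value `𝔡 u ∈ E_m` of `𝔡 ∈ (𝔇E)_m` on a section `u`. -/
def gaugeAct {m : M} (d : GaugeFiber n F E m) : Sec n F E →ₗ[ℝ] E m := d.1.1

/-- The anchor `α : 𝔇E → TM` of the gauge Lie algebroid. -/
def gaugeAnchor (m : M) : GaugeFiber n F E m →ₗ[ℝ] TangentSpace (𝓡 n) m :=
  (LinearMap.snd ℝ _ _).comp (gaugeSubmodule n F E m).subtype

@[simp] lemma gaugeAct_zero {m : M} (u : Sec n F E) :
    gaugeAct (0 : GaugeFiber n F E m) u = 0 := rfl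

@[simp] lemma gaugeAct_add {m : M} (d d' : GaugeFiber n F E m) (u : Sec n F E) :
    gaugeAct (d + d') u = gaugeAct d u + gaugeAct d' u := rfl

@[simp] lemma gaugeAct_smul {m : M} (r : ℝ) (d : GaugeFiber n F E m) (u : Sec n F E) :
    gaugeAct (r • d) u = r • gaugeAct d u := rfl

lemma gaugeAct_fsmul {m : M} (d : GaugeFiber n F E m) (f : SmoothFun n M) (u : Sec n F E) :
    gaugeAct d (fsmul f u) = f m • gaugeAct d u + dirDeriv (gaugeAnchor m d) f • u m := d.2 f u

lemma gauge_ext {m : M} {d d' : GaugeFiber n F E m} (h : ∀ u, gaugeAct d u = gaugeAct d' u)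
    (h' : gaugeAnchor m d = gaugeAnchor m d') : d = d' :=
  Subtype.ext (Prod.ext (LinearMap.ext h) h')

/-- The inclusion `𝔤𝔩(E_m) → (𝔇E)_m`, `Φ ↦ (u ↦ Φ (u(m)))`, with anchor zero. -/
def glIncl (m : M) (Φ : E m →ₗ[ℝ] E m) : GaugeFiber n F E m :=
  ⟨({ toFun := fun u => Φ (u m)
      map_add' := fun u v => map_add Φ (u m) (v m)
      map_smul' := fun r u => map_smul Φ r (u m) }, 0), fun f u => by
    simp [dirDeriv_zero_left]⟩

@[simp] lemma gaugeAct_glIncl (m : M) (Φ : E m →ₗ[ℝ] E m) (u : Sec n F E) :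
    gaugeAct (glIncl m Φ) u = Φ (u m) := rfl

@[simp] lemma gaugeAnchor_glIncl (m : M) (Φ : E m →ₗ[ℝ] E m) :
    gaugeAnchor m (glIncl m Φ : GaugeFiber n F E m) = 0 := rfl

variable (n F E)

/-- Linear maps `ν : (𝔇E)_m → E_m` with `ν(Φ) = Φ(ν(1))` for all `Φ ∈ 𝔤𝔩(E_m)`. -/
def jetSubmodule (m : M) : Submodule ℝ (GaugeFiber n F E m →ₗ[ℝ] E m) where
  carrier := {ν | ∀ Φ : E m →ₗ[ℝ] E m, ν (glIncl m Φ) = Φ (ν (glIncl m LinearMap.id))}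
  zero_mem' Φ := by simp
  add_mem' {a b} ha hb Φ := by
    simp only [Set.mem_ofPred_eq] at ha hb
    simp [ha Φ, hb Φ]
  smul_mem' r a ha Φ := by
    simp only [Set.mem_ofPred_eq] at ha
    simp [ha Φ]

/-- The fibre `(𝔍E)_m` of the standard `E`-dual bundle `𝔍E` of `𝔇E`, which is canonically
isomorphic to the first jet bundle of `E`. -/
def JetFiber (m : M) : Type _ := jetSubmodule n F E m

instance instAddCommGroupJetFiber (m : M) : AddCommGroup (JetFiber n F E m) :=
  (jetSubmodule n F E m).addCommGroup

instance instModuleJetFiber (m : M) : Module ℝ (JetFiber n F E m) :=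
  (jetSubmodule n F E m).module

variable {n F E} in
/-- The fibrewise pairing `⟨μ, 𝔡⟩_E = μ(𝔡)`, as a bilinear map. -/
def fiberPairing (m : M) : JetFiber n F E m →ₗ[ℝ] GaugeFiber n F E m →ₗ[ℝ] E m :=
  (jetSubmodule n F E m).subtype

variable {n F E} in
lemma fiberPairing_glIncl (m : M) (μ : JetFiber n F E m) (Φ : E m →ₗ[ℝ] E m) :
    fiberPairing m μ (glIncl m Φ) = Φ (fiberPairing m μ (glIncl m LinearMap.id)) := μ.2 Φ

variable {n F E}

variable [IsManifold (𝓡 n) ∞ M]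

/-- Smoothness of a (set-theoretic) section of `E`. -/
def IsSmoothSec (s : ∀ m, E m) : Prop :=
  ContMDiff (𝓡 n) ((𝓡 n).prod 𝓘(ℝ, F)) ∞ fun m => (⟨m, s m⟩ : TotalSpace F E)

variable (n F E)

/-- `Γ(𝔇E)`: the sections `D` of the gauge algebroid such that the anchor of `D` is a smooth
vector field and `m ↦ D_m u` is a smooth section of `E` for every smooth section `u`. -/
def gaugeSections : Submodule ℝ (∀ m : M, GaugeFiber n F E m) where
  carrier := {D | IsSmoothSec (n := n) (F := EuclideanSpace ℝ (Fin n))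
      (E := (TangentSpace (𝓡 n) : M → Type _)) (fun m => gaugeAnchor m (D m)) ∧
    ∀ u : Sec n F E, IsSmoothSec (n := n) (F := F) fun m => gaugeAct (D m) u}
  zero_mem' := ⟨(0 : VecField n M).contMDiff, fun _ => (0 : Sec n F E).contMDiff⟩
  add_mem' ha hb := ⟨ha.1.add_section hb.1, fun u => (ha.2 u).add_section (hb.2 u)⟩
  smul_mem' _ _ ha := ⟨ha.1.const_smul_section, fun u => (ha.2 u).const_smul_section⟩

variable {n F E}

/-- The smooth vector field underlying a section of `𝔇E`. -/
def gaugeField (D : gaugeSections n F E) : VecField n M :=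
  ⟨fun m => gaugeAnchor m (D.1 m), D.2.1⟩

/-- The operator `Γ(E) → Γ(E)` given by a section of `𝔇E`. -/
def gaugeOp (D : gaugeSections n F E) : Sec n F E →ₗ[ℝ] Sec n F E where
  toFun u := ⟨fun m => gaugeAct (D.1 m) u, D.2.2 u⟩
  map_add' u v := by ext m; exact map_add (gaugeAct (D.1 m)) u v
  map_smul' r u := by ext m; exact map_smul (gaugeAct (D.1 m)) r u

@[simp] lemma gaugeOp_apply (D : gaugeSections n F E) (u : Sec n F E) (m : M) :
    gaugeOp D u m = gaugeAct (D.1 m) u := rfl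

@[simp] lemma gaugeField_apply (D : gaugeSections n F E) (m : M) :
    gaugeField D m = gaugeAnchor m (D.1 m) := rfl

lemma gaugeOp_fsmul (D : gaugeSections n F E) (f : SmoothFun n M) (u : Sec n F E) :
    gaugeOp D (fsmul f u) = fsmul f (gaugeOp D u) + fsmul ((gaugeField D).app f) u := by
  ext m; exact gaugeAct_fsmul (D.1 m) f u

/-- A derivative endomorphism of `Γ(E)` (an operator satisfying the Leibniz rule over a vector
field) as a section of `𝔇E`. -/
def mkGauge (T : Sec n F E →ₗ[ℝ] Sec n F E) (x : VecField n M)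
    (h : ∀ f u, T (fsmul f u) = fsmul f (T u) + fsmul (x.app f) u) : gaugeSections n F E :=
  ⟨fun m => ⟨({ toFun := fun u => T u m
                map_add' := fun u v => by rw [map_add]; rfl
                map_smul' := fun r u => by rw [map_smul]; rfl }, x m),
      fun f u => by
        change T (fsmul f u) m = _
        rw [h]; rfl⟩,
    x.contMDiff, fun u => (T u).contMDiff⟩

@[simp] lemma gaugeAct_mkGauge (T : Sec n F E →ₗ[ℝ] Sec n F E) (x : VecField n M)
    (h : ∀ f u, T (fsmul f u) = fsmul f (T u) + fsmul (x.app f) u) (m : M) (u : Sec n F E) :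
    gaugeAct ((mkGauge T x h).1 m) u = T u m := rfl

@[simp] lemma gaugeAnchor_mkGauge (T : Sec n F E →ₗ[ℝ] Sec n F E) (x : VecField n M)
    (h : ∀ f u, T (fsmul f u) = fsmul f (T u) + fsmul (x.app f) u) (m : M) :
    gaugeAnchor m ((mkGauge T x h).1 m) = x m := rfl

lemma gaugeSec_ext {D D' : gaugeSections n F E} (h : ∀ m u, gaugeAct (D.1 m) u = gaugeAct (D'.1 m) u)
    (h' : ∀ m, gaugeAnchor m (D.1 m) = gaugeAnchor m (D'.1 m)) : D = D' :=
  Subtype.ext (funext fun m => gauge_ext (h m) (h' m))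

/-- The product `f D` of a smooth function and a section of `𝔇E`. -/
def gaugeSmul (f : SmoothFun n M) (D : gaugeSections n F E) : gaugeSections n F E :=
  ⟨fun m => f m • D.1 m, f.contMDiff.smul_section D.2.1,
    fun u => f.contMDiff.smul_section (D.2.2 u)⟩

@[simp] lemma gaugeSmul_apply (f : SmoothFun n M) (D : gaugeSections n F E) (m : M) :
    (gaugeSmul f D).1 m = f m • D.1 m := rfl

/-- The commutator of derivative endomorphisms, with anchor the commutator of the anchors. -/
def gaugeBracket [T2Space M] (D R : gaugeSections n F E) : gaugeSections n F E :=
  mkGauge (gaugeOp D ∘ₗ gaugeOp R - gaugeOp R ∘ₗ gaugeOp D)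
    ((gaugeField D).bracket (gaugeField R)) fun f u => by
      ext m
      simp only [LinearMap.sub_apply, LinearMap.comp_apply, gaugeOp_fsmul, map_add,
        ContMDiffSection.coe_sub, ContMDiffSection.coe_add, Pi.sub_apply, Pi.add_apply,
        fsmul_apply, VecField.app_apply, dirDeriv_bracket]
      module

lemma gaugeBracket_smul_right [T2Space M] (D R : gaugeSections n F E) (f : SmoothFun n M) :
    gaugeBracket D (gaugeSmul f R) =
      gaugeSmul f (gaugeBracket D R) + gaugeSmul ((gaugeField D).app f) R := by
  have h : ∀ u, gaugeOp (gaugeSmul f R) u = fsmul f (gaugeOp R u) := fun _ => rfl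
  refine gaugeSec_ext (fun m u => ?_) fun m => ?_
  · change (gaugeOp D (gaugeOp (gaugeSmul f R) u) - gaugeOp (gaugeSmul f R) (gaugeOp D u)) m =
      f m • (gaugeOp D (gaugeOp R u) - gaugeOp R (gaugeOp D u)) m +
        (gaugeField D).app f m • gaugeOp R u m
    rw [h, h, gaugeOp_fsmul]
    simp only [ContMDiffSection.coe_sub, ContMDiffSection.coe_add, Pi.sub_apply, Pi.add_apply,
      fsmul_apply]
    module
  · have := congrArg (fun v : VecField n M => v m)
      (VecField.bracket_fsmul (gaugeField D) (gaugeField R) f)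
    exact this.trans (add_comm _ _)

lemma gaugeBracket_const_smul_right [T2Space M] (D R : gaugeSections n F E) (r : ℝ) :
    gaugeBracket D (r • R) = r • gaugeBracket D R := by
  have h : ∀ u, gaugeOp (r • R) u = r • gaugeOp R u := fun _ => rfl
  refine gaugeSec_ext (fun m u => ?_) fun m => ?_
  · change (gaugeOp D (gaugeOp (r • R) u) - gaugeOp (r • R) (gaugeOp D u)) m =
      r • (gaugeOp D (gaugeOp R u) - gaugeOp R (gaugeOp D u)) m
    rw [h, h, map_smul]
    simp only [ContMDiffSection.coe_sub, ContMDiffSection.coe_smul, Pi.sub_apply, Pi.smul_apply]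
    module
  · exact congrArg (fun v : VecField n M => v m)
      (VecField.bracket_const_smul (gaugeField D) (gaugeField R) r)

lemma gaugeBracket_add_right [T2Space M] (D R R' : gaugeSections n F E) :
    gaugeBracket D (R + R') = gaugeBracket D R + gaugeBracket D R' := by
  have h : ∀ u, gaugeOp (R + R') u = gaugeOp R u + gaugeOp R' u := fun _ => rfl
  refine gaugeSec_ext (fun m u => ?_) fun m => ?_
  · change (gaugeOp D (gaugeOp (R + R') u) - gaugeOp (R + R') (gaugeOp D u)) m =
      (gaugeOp D (gaugeOp R u) - gaugeOp R (gaugeOp D u)) m +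
        (gaugeOp D (gaugeOp R' u) - gaugeOp R' (gaugeOp D u)) m
    rw [h, h, map_add]
    simp only [ContMDiffSection.coe_sub, ContMDiffSection.coe_add, Pi.sub_apply, Pi.add_apply]
    module
  · exact congrArg (fun v : VecField n M => v m)
      (VecField.bracket_add (gaugeField D) (gaugeField R) (gaugeField R'))

/-- The identity operator, as a section of `𝔇E`. -/
def gaugeOne : gaugeSections n F E :=
  mkGauge LinearMap.id 0 fun f u => by
    ext m
    simp [dirDeriv_zero_left]

variable (n F E)

/-- `Γ(𝔍E)`: a section `μ` of `𝔍E ⊆ Hom(𝔇E, E)` is smooth if it maps smooth sections of `𝔇E` to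
smooth sections of `E`. -/
def jetSections : Submodule ℝ (∀ m : M, JetFiber n F E m) where
  carrier := {μ | ∀ D : gaugeSections n F E,
    IsSmoothSec (n := n) (F := F) fun m => fiberPairing m (μ m) (D.1 m)}
  zero_mem' _ := (0 : Sec n F E).contMDiff
  add_mem' ha hb D := (ha D).add_section (hb D)
  smul_mem' _ _ ha D := (ha D).const_smul_section

variable {n F E}

/-- The `E`-valued pairing `⟨μ, D⟩_E ∈ Γ(E)` of sections of `𝔍E` and `𝔇E`. -/
def pairing (μ : jetSections n F E) (D : gaugeSections n F E) : Sec n F E :=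
  ⟨fun m => fiberPairing m (μ.1 m) (D.1 m), μ.2 D⟩

@[simp] lemma pairing_apply (μ : jetSections n F E) (D : gaugeSections n F E) (m : M) :
    pairing μ D m = fiberPairing m (μ.1 m) (D.1 m) := rfl

/-- The section `𝕕u = [u]` of `𝔍E` for `u ∈ Γ(E)`: `⟨𝕕u, 𝔡⟩_E = 𝔡 u`. -/
def jet (u : Sec n F E) : jetSections n F E :=
  ⟨fun _ => ⟨{ toFun := fun d => gaugeAct d u
               map_add' := fun _ _ => rfl
               map_smul' := fun _ _ => rfl }, fun _ => rfl⟩, fun D => D.2.2 u⟩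

lemma gaugeAct_sum {ι : Type*} (t : Finset ι) (R : ι → gaugeSections n F E) (p : M)
    (u : Sec n F E) : gaugeAct ((∑ i ∈ t, R i).1 p) u = ∑ i ∈ t, gaugeAct ((R i).1 p) u := by
  classical
  induction t using Finset.induction_on with
  | empty => simp
  | insert i t hi ih =>
    rw [Finset.sum_insert hi, Finset.sum_insert hi, ← ih]
    rfl

lemma gaugeAnchor_sum {ι : Type*} (t : Finset ι) (R : ι → gaugeSections n F E) (p : M) :
    gaugeAnchor p ((∑ i ∈ t, R i).1 p) = ∑ i ∈ t, gaugeAnchor p ((R i).1 p) := by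
  rw [← map_sum, AddSubmonoidClass.coe_finsetSum, Finset.sum_apply]

/-- For `D ∈ Γ(𝔇E)` and `μ ∈ Γ(𝔍E)`, the operator
`D' ↦ D⟨μ, D'⟩_E - ⟨μ, [D, D']⟩_E` on `Γ(𝔇E)`. -/
def lieOp [T2Space M] (D : gaugeSections n F E) (μ : jetSections n F E) :
    gaugeSections n F E →ₗ[ℝ] Sec n F E where
  toFun D' := gaugeOp D (pairing μ D') - pairing μ (gaugeBracket D D')
  map_add' R R' := by
    have h1 : pairing μ (R + R') = pairing μ R + pairing μ R' := by
      ext m; exact map_add (fiberPairing m (μ.1 m)) _ _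
    have h2 : pairing μ (gaugeBracket D (R + R')) =
        pairing μ (gaugeBracket D R) + pairing μ (gaugeBracket D R') := by
      rw [gaugeBracket_add_right]
      ext m; exact map_add (fiberPairing m (μ.1 m)) _ _
    rw [h1, h2, map_add]
    abel
  map_smul' r R := by
    have h1 : pairing μ (r • R) = r • pairing μ R := by
      ext m; exact map_smul (fiberPairing m (μ.1 m)) _ _
    have h2 : pairing μ (gaugeBracket D (r • R)) = r • pairing μ (gaugeBracket D R) := by
      rw [gaugeBracket_const_smul_right]
      ext m; exact map_smul (fiberPairing m (μ.1 m)) _ _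
    rw [h1, h2, map_smul, smul_sub]
    rfl

lemma lieOp_smul [T2Space M] (D : gaugeSections n F E) (μ : jetSections n F E) (f : SmoothFun n M)
    (R : gaugeSections n F E) : lieOp D μ (gaugeSmul f R) = fsmul f (lieOp D μ R) := by
  have h1 : pairing μ (gaugeSmul f R) = fsmul f (pairing μ R) := by
    ext m; exact map_smul (fiberPairing m (μ.1 m)) _ _
  have h2 : pairing μ (gaugeBracket D (gaugeSmul f R)) =
      fsmul f (pairing μ (gaugeBracket D R)) + fsmul ((gaugeField D).app f) (pairing μ R) := by
    rw [gaugeBracket_smul_right]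
    ext m
    change fiberPairing m (μ.1 m) (_ • _ + _ • _) = _
    rw [map_add, map_smul, map_smul]
    rfl
  change gaugeOp D (pairing μ (gaugeSmul f R)) - pairing μ (gaugeBracket D (gaugeSmul f R)) =
    fsmul f (gaugeOp D (pairing μ R) - pairing μ (gaugeBracket D R))
  rw [h1, h2, gaugeOp_fsmul]
  ext m
  simp only [ContMDiffSection.coe_sub, ContMDiffSection.coe_add, Pi.sub_apply, Pi.add_apply,
    fsmul_apply]
  module

section Local
variable [T2Space M] [FiniteDimensional ℝ F] [ContMDiffVectorBundle ∞ F E (𝓡 n)]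

/-- The endomorphism `u ↦ ∑ c_j(u) w_j` for function-linear maps `c_j`. -/
def endGauge {k : ℕ} (c : Fin k → Sec n F E →ₗ[ℝ] SmoothFun n M)
    (hc : ∀ j f u, c j (fsmul f u) = f * c j u) (w : Fin k → Sec n F E) : gaugeSections n F E :=
  mkGauge
    { toFun := fun u => ∑ j, fsmul (c j u) (w j)
      map_add' := fun u v => by
        ext m
        simp [sec_sum_apply, add_smul, Finset.sum_add_distrib]
      map_smul' := fun r u => by
        ext m
        simp [sec_sum_apply, mul_smul, Finset.smul_sum] } 0 fun f u => by
    ext m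
    simp [sec_sum_apply, hc, mul_smul, Finset.smul_sum, dirDeriv_zero_left]

/-- The derivative endomorphism `u ↦ ∑ x(c_j(u)) s_j` over `ψ x`, for a local frame `s_j` with
coefficients `c_j`. -/
def connGauge {k : ℕ} {s : Fin k → Sec n F E} {c : Fin k → Sec n F E →ₗ[ℝ] SmoothFun n M}
    {ψ : SmoothFun n M} (hc : ∀ j f u, c j (fsmul f u) = f * c j u)
    (hs : ∀ u, ∑ j, fsmul (c j u) (s j) = fsmul ψ u) (x : VecField n M) : gaugeSections n F E :=
  mkGauge
    { toFun := fun u => ∑ j, fsmul (x.app (c j u)) (s j)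
      map_add' := fun u v => by
        ext m
        simp [sec_sum_apply, add_smul, Finset.sum_add_distrib, dirDeriv_add]
      map_smul' := fun r u => by
        ext m
        simp [sec_sum_apply, mul_smul, Finset.smul_sum, dirDeriv_const_smul] }
    (fsmul ψ x) fun f u => by
    ext m
    have h := congrArg (fun v : Sec n F E => v m) (hs u)
    simp only [sec_sum_apply, fsmul_apply] at h
    simp [sec_sum_apply, hc, dirDeriv_mul, dirDeriv_smul_left, add_smul, Finset.sum_add_distrib,
      Finset.smul_sum, mul_smul]
    rw [smul_comm, ← h, Finset.smul_sum]
    refine Finset.sum_congr rfl fun j _ => ?_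
    rw [smul_comm]

/-- A function-linear operator on `Γ(𝔇E)` with values in `Γ(E)` is pointwise. -/
lemma eq_zero_of_apply_eq_zero (T : gaugeSections n F E →ₗ[ℝ] Sec n F E)
    (hT : ∀ f D, T (gaugeSmul f D) = fsmul f (T D)) (D : gaugeSections n F E) (m : M)
    (hD : D.1 m = 0) : T D m = 0 := by
  obtain ⟨k, s, c, ψ, hψ, hc, hc0, hs⟩ := exists_localFrame (n := n) (F := F) (E := E) m
  obtain ⟨l, z, a, φ, hφ, ha, ha0, hz⟩ := exists_localFrame (n := n)
    (F := EuclideanSpace ℝ (Fin n)) (E := (TangentSpace (𝓡 n) : M → Type _)) m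
  have hψm : ψ m = 1 := hψ.self_of_nhds
  have hφm : φ m = 1 := hφ.self_of_nhds
  have Tsum : ∀ {ι : Type} [Fintype ι] (f : ι → SmoothFun n M) (R : ι → gaugeSections n F E),
      (∀ i, f i m = 0) → T (∑ i, gaugeSmul (f i) (R i)) m = 0 := by
    intro ι _ f R hf
    rw [map_sum, sec_sum_apply]
    exact Finset.sum_eq_zero fun i _ => by simp [hT, hf i]
  have h1 : gaugeSmul ψ D = endGauge c hc (fun j => gaugeOp D (s j)) +
      connGauge hc hs (gaugeField D) + gaugeSmul (-((gaugeField D).app ψ)) gaugeOne := by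
    refine gaugeSec_ext (fun p u => ?_) fun p => ?_
    · have h := congrArg (fun v : Sec n F E => gaugeOp D v p) (hs u)
      simp only [map_sum, sec_sum_apply, gaugeOp_fsmul, ContMDiffSection.coe_add, Pi.add_apply,
        fsmul_apply, Finset.sum_add_distrib] at h
      change ψ p • gaugeAct (D.1 p) u =
        gaugeAct ((endGauge c hc (fun j => gaugeOp D (s j))).1 p) u + gaugeAct ((connGauge hc hs (gaugeField D)).1 p) u +
          (-((gaugeField D).app ψ p)) • u p
      simp only [endGauge, connGauge, gaugeAct_mkGauge, LinearMap.coe_mk, AddHom.coe_mk,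
        sec_sum_apply, fsmul_apply]
      simp only [gaugeOp_apply, VecField.app_apply] at h ⊢
      rw [h]
      module
    · change ψ p • gaugeAnchor p (D.1 p) = 0 + ψ p • gaugeAnchor p (D.1 p) + _ • 0
      simp
  have h2 : ∀ w : Fin k → Sec n F E, gaugeSmul ψ (endGauge c hc w) =
      ∑ i : Fin k × Fin k, gaugeSmul (c i.2 (w i.1)) (endGauge c hc (Pi.single i.1 (s i.2))) := by
    intro w
    refine gaugeSec_ext (fun p u => ?_) fun p => ?_
    · rw [gaugeAct_sum]
      change ψ p • (∑ j, fsmul (c j u) (w j)) p = ∑ i : Fin k × Fin k, c i.2 (w i.1) p •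
        (∑ j, fsmul (c j u) ((Pi.single i.1 (s i.2) : Fin k → Sec n F E) j)) p
      rw [Fintype.sum_prod_type]
      have e : ∀ i i', (∑ j, fsmul (c j u) ((Pi.single i (s i') : Fin k → Sec n F E) j)) p =
          c i u p • s i' p := by
        intro i i'
        rw [sec_sum_apply, Finset.sum_eq_single i]
        · simp
        · intro j _ hj
          simp [Pi.single_eq_of_ne hj]
        · simp
      simp only [e, sec_sum_apply, Finset.smul_sum]
      refine Finset.sum_congr rfl fun j _ => ?_
      have h := congrArg (fun v : Sec n F E => v p) (hs (w j))
      simp only [sec_sum_apply, fsmul_apply] at h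
      rw [fsmul_apply, smul_comm, ← h, Finset.smul_sum]
      exact Finset.sum_congr rfl fun i _ => smul_comm _ _ _
    · rw [gaugeAnchor_sum]
      change ψ p • (0 : TangentSpace (𝓡 n) p) = ∑ i : Fin k × Fin k, c i.2 (w i.1) p •
        (0 : TangentSpace (𝓡 n) p)
      simp
  have h3 : ∀ x : VecField n M, gaugeSmul φ (connGauge hc hs x) =
      ∑ i, gaugeSmul (a i x) (connGauge hc hs (z i)) := by
    intro x
    refine gaugeSec_ext (fun p u => ?_) fun p => ?_
    · rw [gaugeAct_sum]
      change φ p • (∑ j, fsmul (x.app (c j u)) (s j)) p =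
        ∑ i, a i x p • (∑ j, fsmul (VecField.app (z i) (c j u)) (s j)) p
      have h := congrArg (fun v : VecField n M => v p) (hz x)
      simp only [sec_sum_apply, fsmul_apply] at h
      simp only [sec_sum_apply, fsmul_apply, VecField.app_apply, Finset.smul_sum]
      rw [Finset.sum_comm]
      refine Finset.sum_congr rfl fun j _ => ?_
      simp only [smul_smul, ← dirDeriv_smul_left]
      rw [← h, dirDeriv_sum_left, Finset.sum_smul]
    · rw [gaugeAnchor_sum]
      change φ p • ψ p • x p = ∑ i, a i x p • ψ p • z i p
      have h := congrArg (fun v : VecField n M => v p) (hz x)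
      simp only [sec_sum_apply, fsmul_apply] at h
      rw [smul_comm, ← h, Finset.smul_sum]
      exact Finset.sum_congr rfl fun i _ => smul_comm _ _ _
  have e2 : T (endGauge c hc (fun j => gaugeOp D (s j))) m = 0 := by
    have := congrArg (fun R => T R m) (h2 fun j => gaugeOp D (s j))
    simp only [hT, fsmul_apply, hψm, one_smul] at this
    rw [this, Tsum]
    intro i
    exact hc0 _ _ _ (by simp [hD])
  have e3 : T (connGauge hc hs (gaugeField D)) m = 0 := by
    have := congrArg (fun R => T R m) (h3 (gaugeField D))
    simp only [hT, fsmul_apply, hφm, one_smul] at this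
    rw [this, Tsum]
    intro i
    exact ha0 _ _ _ (by simp [hD])
  have := congrArg (fun R => T R m) h1
  simpa [hT, hψm, e2, e3, hD, dirDeriv_zero_left] using this

/-- Every element of `(𝔇E)_m` extends to a smooth section of `𝔇E`. -/
lemma exists_gaugeSection (m : M) (d : GaugeFiber n F E m) :
    ∃ D : gaugeSections n F E, D.1 m = d := by
  obtain ⟨k, s, c, ψ, hψ, hc, hc0, hs⟩ := exists_localFrame (n := n) (F := F) (E := E) m
  have hψm : ψ m = 1 := hψ.self_of_nhds
  obtain ⟨x, hx⟩ := exists_section_apply_eq (n := n) (F := EuclideanSpace ℝ (Fin n)) m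
    (gaugeAnchor m d)
  choose w hw using fun j => exists_section_apply_eq (n := n) (F := F) m (gaugeAct d (s j))
  refine ⟨endGauge c hc w + connGauge hc hs x, gauge_ext (fun u => ?_) ?_⟩
  · have h := congrArg (gaugeAct d) (hs u)
    rw [map_sum, gaugeAct_fsmul, hψm, dirDeriv_congr (g := 1) _ hψ, dirDeriv_one] at h
    simp only [gaugeAct_fsmul, Finset.sum_add_distrib, one_smul, zero_smul, add_zero] at h
    rw [← h]
    change gaugeAct ((endGauge c hc w).1 m) u + gaugeAct ((connGauge hc hs x).1 m) u = _
    simp [endGauge, connGauge, sec_sum_apply, hw, hx]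
  · change 0 + ψ m • x m = _
    simp [hψm, hx]

/-- The kernel of the anchor `(𝔇E)_m → T_m M` is `𝔤𝔩(E_m)`. -/
lemma exists_eq_glIncl (m : M) (d : GaugeFiber n F E m) (hd : gaugeAnchor m d = 0) :
    ∃ Φ : E m →ₗ[ℝ] E m, d = glIncl m Φ := by
  obtain ⟨k, s, c, ψ, hψ, hc, hc0, hs⟩ := exists_localFrame (n := n) (F := F) (E := E) m
  have h0 : ∀ f u, gaugeAct d (fsmul f u) = f m • gaugeAct d u := fun f u => by
    rw [gaugeAct_fsmul, hd, dirDeriv_zero_left, zero_smul, add_zero]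
  have h1 : ∀ u : Sec n F E, u m = 0 → gaugeAct d u = 0 := by
    intro u hu
    have h := congrArg (gaugeAct d) (hs u)
    rw [map_sum, h0, hψ.self_of_nhds, one_smul] at h
    rw [← h]
    exact Finset.sum_eq_zero fun j _ => by rw [h0, hc0 j u m hu, zero_smul]
  have h2 : ∀ u v : Sec n F E, u m = v m → gaugeAct d u = gaugeAct d v := by
    intro u v h
    rw [← sub_eq_zero, ← map_sub]
    exact h1 _ (sub_eq_zero.2 h)
  choose w hw using fun e : E m => exists_section_apply_eq (n := n) (F := F) m e
  refine ⟨{ toFun := fun e => gaugeAct d (w e)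
            map_add' := fun e e' => ?_
            map_smul' := fun r e => ?_ }, gauge_ext (fun u => ?_) hd⟩
  · rw [← map_add]
    exact h2 _ _ (by simp [hw])
  · rw [RingHom.id_apply, ← map_smul]
    exact h2 _ _ (by simp [hw])
  · exact h2 _ _ (hw _).symm

/-- Every `Φ ∈ 𝔤𝔩(E_m)` extends to a smooth section of `𝔤𝔩(E) ⊆ 𝔇E`. -/
lemma exists_endSection (m : M) (Φ : E m →ₗ[ℝ] E m) :
    ∃ D : gaugeSections n F E, D.1 m = glIncl m Φ ∧ gaugeField D = 0 := by
  obtain ⟨k, s, c, ψ, hψ, hc, hc0, hs⟩ := exists_localFrame (n := n) (F := F) (E := E) m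
  have hψm : ψ m = 1 := hψ.self_of_nhds
  choose w hw using fun j => exists_section_apply_eq (n := n) (F := F) m (Φ (s j m))
  refine ⟨endGauge c hc w, gauge_ext (fun u => ?_) rfl, rfl⟩
  have h := congrArg (fun v : Sec n F E => Φ (v m)) (hs u)
  simp [sec_sum_apply, hψm] at h
  simp [endGauge, sec_sum_apply, hw, h]

lemma lieOp_congr (D : gaugeSections n F E) (μ : jetSections n F E) (m : M)
    (R R' : gaugeSections n F E) (h : R.1 m = R'.1 m) : lieOp D μ R m = lieOp D μ R' m := by
  have h0 : (R + (-1 : ℝ) • R').1 m = 0 := by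
    change R.1 m + (-1 : ℝ) • R'.1 m = 0
    rw [h]; module
  have := eq_zero_of_apply_eq_zero (lieOp D μ) (lieOp_smul D μ) _ m h0
  rw [map_add, map_smul] at this
  change lieOp D μ R m + (-1 : ℝ) • lieOp D μ R' m = 0 at this
  rw [← sub_eq_zero, ← this]
  module

lemma pairing_eq_gaugeOp (μ : jetSections n F E) (Q : gaugeSections n F E)
    (hQ : gaugeField Q = 0) : pairing μ Q = gaugeOp Q (pairing μ gaugeOne) := by
  ext p
  obtain ⟨Ψ, hΨ⟩ := exists_eq_glIncl p (Q.1 p) (congrArg (fun x : VecField n M => x p) hQ)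
  rw [pairing_apply, gaugeOp_apply, hΨ, gaugeAct_glIncl, fiberPairing_glIncl]
  rfl

lemma lieOp_end (D : gaugeSections n F E) (μ : jetSections n F E) (m : M) (Φ : E m →ₗ[ℝ] E m)
    (R : gaugeSections n F E) (hR : R.1 m = glIncl m Φ) (hR0 : gaugeField R = 0) :
    lieOp D μ R m = Φ (gaugeOp D (pairing μ gaugeOne) m) := by
  have hB : gaugeField (gaugeBracket D R) = 0 := by
    change (gaugeField D).bracket (gaugeField R) = 0
    rw [hR0, VecField.bracket_zero]
  have h1 : lieOp D μ R =
      gaugeOp D (pairing μ R) - pairing μ (gaugeBracket D R) := rfl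
  have h2 : ∀ u, gaugeOp (gaugeBracket D R) u =
      gaugeOp D (gaugeOp R u) - gaugeOp R (gaugeOp D u) := fun _ => rfl
  rw [h1, pairing_eq_gaugeOp μ R hR0, pairing_eq_gaugeOp μ _ hB, h2, sub_sub_cancel,
    gaugeOp_apply, hR, gaugeAct_glIncl]

lemma exists_lieDer (D : gaugeSections n F E) (μ : jetSections n F E) :
    ∃ ν : jetSections n F E, ∀ D' : gaugeSections n F E,
      pairing ν D' = gaugeOp D (pairing μ D') - pairing μ (gaugeBracket D D') := by
  have wd := lieOp_congr D μ
  choose ex hex using fun m => exists_gaugeSection (n := n) (F := F) (E := E) m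
  let ν : ∀ m : M, GaugeFiber n F E m →ₗ[ℝ] E m := fun m =>
    { toFun := fun d => lieOp D μ (ex m d) m
      map_add' := fun d d' => by
        rw [wd m (ex m (d + d')) (ex m d + ex m d') (by
          rw [hex]; change _ = (ex m d).1 m + (ex m d').1 m; rw [hex, hex]), map_add]
        rfl
      map_smul' := fun r d => by
        rw [wd m (ex m (r • d)) (r • ex m d) (by
          rw [hex]; change _ = r • (ex m d).1 m; rw [hex]), map_smul]
        rfl }
  have hν : ∀ (R : gaugeSections n F E) (m : M), ν m (R.1 m) = lieOp D μ R m := fun R m =>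
    wd m _ _ (hex m _)
  have key : ∀ (m : M) (Φ : E m →ₗ[ℝ] E m),
      ν m (glIncl m Φ) = Φ (gaugeOp D (pairing μ gaugeOne) m) := by
    intro m Φ
    obtain ⟨R, hR, hR0⟩ := exists_endSection (n := n) (F := F) (E := E) m Φ
    rw [← hR, hν]
    exact lieOp_end D μ m Φ R hR hR0
  refine ⟨⟨fun m => ⟨ν m, fun Φ => ?_⟩, fun R => ?_⟩, fun R => ?_⟩
  · rw [key, key]; rfl
  · have : (fun m => ν m (R.1 m)) = fun m => lieOp D μ R m := funext (hν R)
    change IsSmoothSec fun m => ν m (R.1 m)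
    rw [this]
    exact (lieOp D μ R).contMDiff
  · ext m
    exact hν R m

lemma jet_ext {μ ν : jetSections n F E} (h : ∀ D, pairing μ D = pairing ν D) : μ = ν := by
  refine Subtype.ext (funext fun m => Subtype.ext (LinearMap.ext fun d => ?_))
  obtain ⟨D, rfl⟩ := exists_gaugeSection m d
  exact congrArg (fun u : Sec n F E => u m) (h D)

/-- The Lie derivative `𝔏_D μ ∈ Γ(𝔍E)`: the section with
`⟨𝔏_D μ, D'⟩_E = D⟨μ, D'⟩_E - ⟨μ, [D, D']⟩_E` for all `D' ∈ Γ(𝔇E)` (unique by `jet_ext`). -/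
def lieDer (D : gaugeSections n F E) (μ : jetSections n F E) : jetSections n F E :=
  (exists_lieDer D μ).choose

lemma pairing_lieDer (D : gaugeSections n F E) (μ : jetSections n F E)
    (D' : gaugeSections n F E) :
    pairing (lieDer D μ) D' = gaugeOp D (pairing μ D') - pairing μ (gaugeBracket D D') :=
  (exists_lieDer D μ).choose_spec D'

end Local

end Gauge

section Omni

variable (n : ℕ) {M : Type*} [TopologicalSpace M] [ChartedSpace (EuclideanSpace ℝ (Fin n)) M]
    (F : Type*) [NormedAddCommGroup F] [NormedSpace ℝ F] (E : M → Type*)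
    [TopologicalSpace (TotalSpace F E)] [∀ m, AddCommGroup (E m)] [∀ m, Module ℝ (E m)]
    [∀ m, TopologicalSpace (E m)] [FiberBundle F E] [VectorBundle ℝ F E]
    [IsManifold (𝓡 n) ∞ M]

/-- The fibre at `m` of `𝓔 = 𝔇E ⊕ 𝔍E`. -/
abbrev OmniFiber (m : M) : Type _ := GaugeFiber n F E m × JetFiber n F E m

/-- `Γ(𝓔) = Γ(𝔇E) ⊕ Γ(𝔍E)`. -/
def omniSections : Submodule ℝ (∀ m : M, OmniFiber n F E m) where
  carrier := {X | (fun m => (X m).1) ∈ gaugeSections n F E ∧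
    (fun m => (X m).2) ∈ jetSections n F E}
  zero_mem' := ⟨(gaugeSections n F E).zero_mem, (jetSections n F E).zero_mem⟩
  add_mem' ha hb :=
    ⟨(gaugeSections n F E).add_mem ha.1 hb.1, (jetSections n F E).add_mem ha.2 hb.2⟩
  smul_mem' r _ ha :=
    ⟨(gaugeSections n F E).smul_mem r ha.1, (jetSections n F E).smul_mem r ha.2⟩

variable {n F E}

/-- The projection `ρ : 𝓔 → 𝔇E`. -/
def rho (m : M) : OmniFiber n F E m →ₗ[ℝ] GaugeFiber n F E m := LinearMap.fst ℝ _ _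

/-- The `𝔇E`-component of a section of `𝓔`. -/
def gaugePart (X : omniSections n F E) : gaugeSections n F E := ⟨fun m => (X.1 m).1, X.2.1⟩

/-- The `𝔍E`-component of a section of `𝓔`. -/
def jetPart (X : omniSections n F E) : jetSections n F E := ⟨fun m => (X.1 m).2, X.2.2⟩

/-- The symmetric `E`-valued form `(𝔡 + μ, 𝔯 + ν)_E = ½ (⟨𝔡, ν⟩_E + ⟨𝔯, μ⟩_E)` on `𝓔_m`. -/
def omniPairing {m : M} (X Y : OmniFiber n F E m) : E m :=
  (1 / 2 : ℝ) • (fiberPairing m Y.2 X.1 + fiberPairing m X.2 Y.1)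

/-- The Dorfman bracket on `Γ(𝓔)`:
`{𝔡 + μ, 𝔯 + ν} = [𝔡, 𝔯] + 𝔏_𝔡 ν - 𝔏_𝔯 μ + 𝕕⟨μ, 𝔯⟩_E`. -/
def dorfman [T2Space M] [FiniteDimensional ℝ F] [ContMDiffVectorBundle ∞ F E (𝓡 n)]
    (X Y : omniSections n F E) : omniSections n F E :=
  ⟨fun m => ((gaugeBracket (gaugePart X) (gaugePart Y)).1 m,
      (lieDer (gaugePart X) (jetPart Y) - lieDer (gaugePart Y) (jetPart X) +
        jet (pairing (jetPart X) (gaugePart Y))).1 m),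
    (gaugeBracket (gaugePart X) (gaugePart Y)).2,
    (lieDer (gaugePart X) (jetPart Y) - lieDer (gaugePart Y) (jetPart X) +
        jet (pairing (jetPart X) (gaugePart Y))).2⟩

end Omni

section Algebroid

variable (n : ℕ) {M : Type*} [TopologicalSpace M] [ChartedSpace (EuclideanSpace ℝ (Fin n)) M]
    {A : M → Type*} [∀ m, AddCommGroup (A m)] [∀ m, Module ℝ (A m)]

/-- A family of real vector spaces `A_m`, `m ∈ M`, with a space `Γ` of sections, is a smooth vector
bundle with `Γ` as its space of smooth sections: `Γ` is a module over the smooth functions, being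
in `Γ` is a local property, and around every point there are finitely many sections in `Γ` that
form a basis of each nearby fibre and with respect to which every section in `Γ` has smooth
coefficients. (On a Hausdorff manifold, germs of smooth functions and of smooth sections are germs
of global ones. The rank may differ between connected components.) -/
structure IsSmoothBundle (Γ : Submodule ℝ (∀ m, A m)) : Prop where
  smul_mem : ∀ (f : SmoothFun n M) {s : ∀ m, A m}, s ∈ Γ → (fun m => f m • s m) ∈ Γ
  mem_of_locally : ∀ s : ∀ m, A m, (∀ m, ∃ t ∈ Γ, ∀ᶠ p in 𝓝 m, s p = t p) → s ∈ Γ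
  exists_frame : ∀ m : M, ∃ (r : ℕ) (e : Fin r → Γ),
    (∀ᶠ p in 𝓝 m, LinearIndependent ℝ (fun i => (e i).1 p) ∧
      Submodule.span ℝ (Set.range fun i => (e i).1 p) = ⊤) ∧
    ∀ s ∈ Γ, ∃ c : Fin r → SmoothFun n M, ∀ᶠ p in 𝓝 m, s p = ∑ i, c i p • (e i).1 p

variable [IsManifold (𝓡 n) ∞ M]

/-- A Lie algebroid over `M`: a smooth vector bundle `A`, a Lie bracket on its space `Γ` of smooth
sections and a smooth bundle map `a : A → TM`, the anchor, such that
`[s, f t] = f [s, t] + a(s)(f) t` and `a[s, t] = [a(s), a(t)]`. -/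
structure IsLieAlgebroid (Γ : Submodule ℝ (∀ m, A m)) (bracket : Γ → Γ → Γ)
    (a : ∀ m, A m →ₗ[ℝ] TangentSpace (𝓡 n) m) : Prop where
  isSmoothBundle : IsSmoothBundle n Γ
  anchor_smooth : ∀ s : Γ, IsSmoothSec (n := n) (F := EuclideanSpace ℝ (Fin n))
    (E := (TangentSpace (𝓡 n) : M → Type _)) (fun m => a m (s.1 m))
  add_left : ∀ s s' t, bracket (s + s') t = bracket s t + bracket s' t
  smul_left : ∀ (r : ℝ) s t, bracket (r • s) t = r • bracket s t
  add_right : ∀ s t t', bracket s (t + t') = bracket s t + bracket s t'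
  smul_right : ∀ (r : ℝ) s t, bracket s (r • t) = r • bracket s t
  alternating : ∀ s, bracket s s = 0
  jacobi : ∀ s t u,
    bracket s (bracket t u) + bracket t (bracket u s) + bracket u (bracket s t) = 0
  leibniz : ∀ (f : SmoothFun n M) (s t : Γ) (m : M),
    (bracket s ⟨fun p => f p • t.1 p, isSmoothBundle.smul_mem f t.2⟩).1 m =
      f m • (bracket s t).1 m + dirDeriv (a m (s.1 m)) f • t.1 m
  anchor_bracket : ∀ (s t : Γ) (m : M), a m ((bracket s t).1 m) =
    VectorField.mlieBracket (𝓡 n) (fun p => a p (s.1 p)) (fun p => a p (t.1 p)) m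

variable {n}
variable {F : Type*} [NormedAddCommGroup F] [NormedSpace ℝ F] {E : M → Type*}
    [TopologicalSpace (TotalSpace F E)] [∀ m, AddCommGroup (E m)] [∀ m, Module ℝ (E m)]
    [∀ m, TopologicalSpace (E m)] [FiberBundle F E] [VectorBundle ℝ F E] [T2Space M]

/-- A representation on `E` of a Lie algebroid `A` with smooth sections `Γ` and anchor `a`: a
morphism of Lie algebroids `T : A → 𝔇E` over the identity of `M`, that is, a smooth bundle map
compatible with the anchors and with the brackets. -/
structure IsRepresentation (Γ : Submodule ℝ (∀ m, A m)) (bracket : Γ → Γ → Γ)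
    (a : ∀ m, A m →ₗ[ℝ] TangentSpace (𝓡 n) m)
    (T : ∀ m, A m →ₗ[ℝ] GaugeFiber n F E m) : Prop where
  smooth : ∀ s : Γ, (fun m => T m (s.1 m)) ∈ gaugeSections n F E
  anchor : ∀ m (v : A m), gaugeAnchor m (T m v) = a m v
  map_bracket : ∀ (s t : Γ) (m : M), T m ((bracket s t).1 m) =
    (gaugeBracket ⟨fun p => T p (s.1 p), smooth s⟩ ⟨fun p => T p (t.1 p), smooth t⟩).1 m

end Algebroid

section Dirac

variable {n : ℕ} {M : Type*} [TopologicalSpace M] [ChartedSpace (EuclideanSpace ℝ (Fin n)) M]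
    {F : Type*} [NormedAddCommGroup F] [NormedSpace ℝ F] {E : M → Type*}
    [TopologicalSpace (TotalSpace F E)] [∀ m, AddCommGroup (E m)] [∀ m, Module ℝ (E m)]
    [∀ m, TopologicalSpace (E m)] [FiberBundle F E] [VectorBundle ℝ F E]
    [IsManifold (𝓡 n) ∞ M]

/-- `Γ(L)` for a family `L` of subspaces of the fibres of `𝓔`: the smooth sections of `𝓔` with
values in `L`. -/
def subSections (L : ∀ m : M, Submodule ℝ (OmniFiber n F E m)) : Submodule ℝ (∀ m, L m) where
  carrier := {s | (fun m => (s m : OmniFiber n F E m)) ∈ omniSections n F E}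
  zero_mem' := (omniSections n F E).zero_mem
  add_mem' ha hb := (omniSections n F E).add_mem ha hb
  smul_mem' r _ ha := (omniSections n F E).smul_mem r ha

/-- A section of `L` as a section of `𝓔`. -/
def inclSection {L : ∀ m : M, Submodule ℝ (OmniFiber n F E m)} (s : subSections L) :
    omniSections n F E := ⟨fun m => (s.1 m : OmniFiber n F E m), s.2⟩

variable [T2Space M] [FiniteDimensional ℝ F] [ContMDiffVectorBundle ∞ F E (𝓡 n)]

/-- A Dirac structure: a subbundle `L` of `𝓔` whose fibres are maximal isotropic and whose space of
smooth sections is closed under the Dorfman bracket. -/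
structure IsDirac (L : ∀ m : M, Submodule ℝ (OmniFiber n F E m)) : Prop where
  isSubbundle : IsSmoothBundle n (A := fun m => L m) (subSections L)
  maximalIsotropic : ∀ m, Maximal (fun W : Submodule ℝ (OmniFiber n F E m) =>
    ∀ v ∈ W, ∀ w ∈ W, omniPairing v w = 0) (L m)
  closed : ∀ (s t : subSections L) (m : M), (dorfman (inclSection s) (inclSection t)).1 m ∈ L m

/-- The Dorfman bracket restricted to the sections of a Dirac structure. -/
def restrictedBracket {L : ∀ m : M, Submodule ℝ (OmniFiber n F E m)} (hL : IsDirac L)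
    (s t : subSections L) : subSections L :=
  ⟨fun m => ⟨(dorfman (inclSection s) (inclSection t)).1 m, hL.closed s t m⟩,
    (dorfman (inclSection s) (inclSection t)).2⟩

/-- The restriction `ρ|_L : L → 𝔇E`. -/
def rhoRestrict (L : ∀ m : M, Submodule ℝ (OmniFiber n F E m)) (m : M) :
    L m →ₗ[ℝ] GaugeFiber n F E m := (rho m).comp (L m).subtype

end Dirac

end OmniLie

end

noncomputable section

namespace OmniLie

/-! ### The Lie algebra of sections of `𝔇E`, and its pairing with sections of `𝔍E`. -/

section GaugeLie

variable {n : ℕ} {M : Type*} [TopologicalSpace M]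
    [ChartedSpace (EuclideanSpace ℝ (Fin n)) M] [IsManifold (𝓡 n) ∞ M]

/-! On all of `Γ(𝓔)` the Dorfman bracket is almost a Lie algebroid bracket. It is `ℝ`-bilinear, each
`{X, ·}` is a derivation of the bracket (`dorfman_leibniz`), and it obeys the Leibniz rule in its
second argument (`dorfman_omniSmul`). Only skew-symmetry fails: for `X = 𝔡 + μ` one has `{X, X} =
𝕕⟨μ, 𝔡⟩_E = 𝕕(X, X)_E`. Isotropy of `L` kills this term (`IsDirac.pairing_self`, `dorfman_self`),
and closure keeps the bracket in `Γ(L)`. There the bracket is alternating, so the derivation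
property becomes the Jacobi identity.

The derivation property rests on a Cartan calculus for `𝔏` and `𝕕`: `𝔏` represents the Lie algebra
`Γ(𝔇E)` on `Γ(𝔍E)` (`lieDer_gaugeBracket`) and `𝔏_D 𝕕u = 𝕕(D u)` (`lieDer_jet`). Both follow from
the formula defining `𝔏` and the Jacobi identity for commutators, because a section of `𝔍E` is
determined by its pairings with smooth sections of `𝔇E` (`jet_ext`).

The statements about `ρ` and the anchor cost nothing: the `𝔇E`-component of the Dorfman bracket is
by construction the commutator, and the anchor of a commutator is by construction the commutator of
the anchors. -/

lemma VecField.bracket_self (u : VecField n M) : u.bracket u = 0 := by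
  ext p
  exact congrFun VectorField.mlieBracket_self p

/-- The Jacobi identity in derivation form; it supplies the anchor half of `gaugeBracket_leibniz`.
-/
lemma VecField.bracket_leibniz (u v w : VecField n M) :
    u.bracket (v.bracket w) = (u.bracket v).bracket w + v.bracket (u.bracket w) := by
  have : IsManifold (𝓡 n) (minSmoothness ℝ 3) M := by
    rw [minSmoothness_of_isRCLikeNormedField]; infer_instance
  have cd : ∀ z : VecField n M, ContMDiff (𝓡 n) (𝓡 n).tangent (minSmoothness ℝ 2)
      (fun p => (⟨p, z p⟩ : TangentBundle (𝓡 n) M)) := fun z => by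
    rw [minSmoothness_of_isRCLikeNormedField]; exact z.contMDiff.of_le ENat.LEInfty.out
  ext p
  exact VectorField.leibniz_identity_mlieBracket_apply (cd u p) (cd v p) (cd w p)

lemma VecField.bracket_swap (u v : VecField n M) : u.bracket v = -v.bracket u := by
  ext p
  exact VectorField.mlieBracket_swap_apply

variable {F : Type*} [NormedAddCommGroup F] [NormedSpace ℝ F] {E : M → Type*}
    [TopologicalSpace (TotalSpace F E)] [∀ m, AddCommGroup (E m)] [∀ m, Module ℝ (E m)]
    [∀ m, TopologicalSpace (E m)] [FiberBundle F E] [VectorBundle ℝ F E]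

/-- Operator and anchor must both be compared: over a bundle of rank zero the operator carries no
information about the anchor. -/
lemma gaugeSections_ext {D D' : gaugeSections n F E} (h : ∀ u, gaugeOp D u = gaugeOp D' u)
    (h' : gaugeField D = gaugeField D') : D = D' :=
  gaugeSec_ext (fun m u => congrArg (fun v : Sec n F E => v m) (h u))
    fun m => congrArg (fun v : VecField n M => v m) h'

lemma gaugeOp_add (D R : gaugeSections n F E) (u : Sec n F E) :
    gaugeOp (D + R) u = gaugeOp D u + gaugeOp R u := rfl

lemma gaugeOp_smul (r : ℝ) (D : gaugeSections n F E) (u : Sec n F E) :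
    gaugeOp (r • D) u = r • gaugeOp D u := rfl

lemma pairing_add_left (μ ν : jetSections n F E) (D : gaugeSections n F E) :
    pairing (μ + ν) D = pairing μ D + pairing ν D := rfl

lemma pairing_sub_left (μ ν : jetSections n F E) (D : gaugeSections n F E) :
    pairing (μ - ν) D = pairing μ D - pairing ν D := rfl

lemma pairing_smul_left (r : ℝ) (μ : jetSections n F E) (D : gaugeSections n F E) :
    pairing (r • μ) D = r • pairing μ D := rfl

lemma pairing_add_right (μ : jetSections n F E) (D R : gaugeSections n F E) :
    pairing μ (D + R) = pairing μ D + pairing μ R := by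
  ext m; exact map_add (fiberPairing m (μ.1 m)) _ _

lemma pairing_smul_right (μ : jetSections n F E) (r : ℝ) (D : gaugeSections n F E) :
    pairing μ (r • D) = r • pairing μ D := by
  ext m; exact map_smul (fiberPairing m (μ.1 m)) _ _

lemma pairing_jet (u : Sec n F E) (D : gaugeSections n F E) :
    pairing (jet u) D = gaugeOp D u := rfl

/-- The product `f μ` of a smooth function and a section of `𝔍E`. -/
def jetSmul (f : SmoothFun n M) (μ : jetSections n F E) : jetSections n F E :=
  ⟨fun m => f m • μ.1 m, fun D => f.contMDiff.smul_section (μ.2 D)⟩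

lemma pairing_gaugeSmul (μ : jetSections n F E) (f : SmoothFun n M) (D : gaugeSections n F E) :
    pairing μ (gaugeSmul f D) = fsmul f (pairing μ D) := by
  ext m; exact map_smul (fiberPairing m (μ.1 m)) _ _

lemma pairing_jetSmul (f : SmoothFun n M) (μ : jetSections n F E) (D : gaugeSections n F E) :
    pairing (jetSmul f μ) D = fsmul f (pairing μ D) := rfl

variable [T2Space M]

lemma gaugeOp_gaugeBracket (D R : gaugeSections n F E) (u : Sec n F E) :
    gaugeOp (gaugeBracket D R) u = gaugeOp D (gaugeOp R u) - gaugeOp R (gaugeOp D u) := rfl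

lemma gaugeBracket_self (D : gaugeSections n F E) : gaugeBracket D D = 0 :=
  gaugeSections_ext (fun _ => sub_self _) (VecField.bracket_self _)

/-- For the operators this is the formal identity for commutators in an associative algebra; for the
anchors it is the Jacobi identity of vector fields. -/
lemma gaugeBracket_leibniz (D R S : gaugeSections n F E) :
    gaugeBracket D (gaugeBracket R S) =
      gaugeBracket (gaugeBracket D R) S + gaugeBracket R (gaugeBracket D S) := by
  refine gaugeSections_ext (fun u => ?_) (VecField.bracket_leibniz _ _ _)
  simp only [gaugeOp_add, gaugeOp_gaugeBracket, map_sub]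
  abel

lemma gaugeBracket_swap (D R : gaugeSections n F E) :
    gaugeBracket D R = -gaugeBracket R D :=
  gaugeSections_ext (fun _ => (neg_sub _ _).symm) (VecField.bracket_swap _ _)

lemma gaugeBracket_add_left (D D' R : gaugeSections n F E) :
    gaugeBracket (D + D') R = gaugeBracket D R + gaugeBracket D' R := by
  rw [gaugeBracket_swap, gaugeBracket_add_right, gaugeBracket_swap R D, gaugeBracket_swap R D']
  abel

lemma gaugeBracket_const_smul_left (r : ℝ) (D R : gaugeSections n F E) :
    gaugeBracket (r • D) R = r • gaugeBracket D R := by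
  rw [gaugeBracket_swap, gaugeBracket_const_smul_right, gaugeBracket_swap R D, smul_neg, neg_neg]

/-! ### Cartan calculus: the Lie derivative `𝔏` and the jet map `𝕕` on `Γ(𝔍E)`. -/

variable [FiniteDimensional ℝ F] [ContMDiffVectorBundle ∞ F E (𝓡 n)]

/-- `lieDer` is a chosen section known only through `pairing_lieDer`, so this and the next
identities are tested by pairing with an arbitrary `R ∈ Γ(𝔇E)`, which `jet_ext` shows to be enough.
-/
lemma lieDer_add_right (D : gaugeSections n F E) (μ ν : jetSections n F E) :
    lieDer D (μ + ν) = lieDer D μ + lieDer D ν := jet_ext fun R => by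
  simp only [pairing_lieDer, pairing_add_left, map_add]
  abel

lemma lieDer_smul_right (D : gaugeSections n F E) (r : ℝ) (μ : jetSections n F E) :
    lieDer D (r • μ) = r • lieDer D μ := jet_ext fun R => by
  simp only [pairing_lieDer, pairing_smul_left, map_smul, smul_sub]

lemma lieDer_sub_right (D : gaugeSections n F E) (μ ν : jetSections n F E) :
    lieDer D (μ - ν) = lieDer D μ - lieDer D ν := jet_ext fun R => by
  simp only [pairing_lieDer, pairing_sub_left, map_sub]
  abel

lemma lieDer_add_left (D D' : gaugeSections n F E) (μ : jetSections n F E) :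
    lieDer (D + D') μ = lieDer D μ + lieDer D' μ := jet_ext fun R => by
  simp only [pairing_lieDer, pairing_add_left, gaugeOp_add, gaugeBracket_add_left,
    pairing_add_right]
  abel

lemma lieDer_smul_left (r : ℝ) (D : gaugeSections n F E) (μ : jetSections n F E) :
    lieDer (r • D) μ = r • lieDer D μ := jet_ext fun R => by
  simp only [pairing_lieDer, pairing_smul_left, gaugeOp_smul, gaugeBracket_const_smul_left,
    pairing_smul_right, smul_sub]

lemma jet_add (u v : Sec n F E) : jet (u + v) = jet u + jet v := jet_ext fun R => by
  simp only [pairing_jet, pairing_add_left, map_add]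

lemma jet_smul (r : ℝ) (u : Sec n F E) : jet (r • u) = r • jet u := jet_ext fun R => by
  simp only [pairing_jet, pairing_smul_left, map_smul]

lemma jet_sub (u v : Sec n F E) : jet (u - v) = jet u - jet v := jet_ext fun R => by
  simp only [pairing_jet, pairing_sub_left, map_sub]

/-- `𝔏_D` commutes with `𝕕`. -/
lemma lieDer_jet (D : gaugeSections n F E) (u : Sec n F E) :
    lieDer D (jet u) = jet (gaugeOp D u) := jet_ext fun R => by
  -- Paired with `R`, the left side is `D(R u) - [D, R] u`, which collapses to `R(D u)`.
  simp only [pairing_lieDer, pairing_jet, gaugeOp_gaugeBracket]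
  abel

/-- `𝔏` is a representation of the Lie algebra `Γ(𝔇E)` on `Γ(𝔍E)`. -/
lemma lieDer_gaugeBracket (D R : gaugeSections n F E) (μ : jetSections n F E) :
    lieDer (gaugeBracket D R) μ = lieDer D (lieDer R μ) - lieDer R (lieDer D μ) :=
  jet_ext fun S => by
    simp only [pairing_lieDer, pairing_sub_left, gaugeOp_gaugeBracket, map_sub]
    -- The mixed terms `D⟨μ, [R, S]⟩` and `R⟨μ, [D, S]⟩` each occur with both signs. What is left
    -- compares three double brackets paired with `μ`, and the Jacobi identity in `Γ(𝔇E)` settles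
    -- it.
    rw [gaugeBracket_leibniz D R S, pairing_add_right]
    abel

/-- The extra term comes from `D` differentiating `f` in `D(f⟨μ, R⟩)`; the bracket term of `𝔏` is
function-linear in `μ`. -/
lemma lieDer_jetSmul (D : gaugeSections n F E) (f : SmoothFun n M) (μ : jetSections n F E) :
    lieDer D (jetSmul f μ) = jetSmul f (lieDer D μ) + jetSmul ((gaugeField D).app f) μ :=
  jet_ext fun R => by
    simp only [pairing_lieDer, pairing_add_left, pairing_jetSmul, gaugeOp_fsmul]
    ext m
    simp only [ContMDiffSection.coe_sub, ContMDiffSection.coe_add, Pi.sub_apply, Pi.add_apply,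
      fsmul_apply]
    module

/-- `𝔏` is not function-linear in `D`, since `[f D, R] = f [D, R] - α(R)(f) D`. The defect sends `R`
to `α(R)(f) ⟨μ, D⟩`; it is stated after pairing, so that this element of `Γ(𝔍E)` need not be built.
In `dorfman_omniSmul` it is cancelled by the derivative of `f` under `𝕕`. -/
lemma lieDer_gaugeSmul (f : SmoothFun n M) (D : gaugeSections n F E) (μ : jetSections n F E)
    (R : gaugeSections n F E) (m : M) :
    pairing (lieDer (gaugeSmul f D) μ) R m =
      f m • pairing (lieDer D μ) R m + dirDeriv (gaugeAnchor m (R.1 m)) f • pairing μ D m := by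
  rw [pairing_lieDer, pairing_lieDer, gaugeBracket_swap, gaugeBracket_smul_right,
    gaugeBracket_swap D R]
  change f m • gaugeOp D (pairing μ R) m - fiberPairing m (μ.1 m)
      (-(f m • (gaugeBracket R D).1 m + dirDeriv (gaugeAnchor m (R.1 m)) f • D.1 m)) =
    f m • (gaugeOp D (pairing μ R) m - fiberPairing m (μ.1 m) (-(gaugeBracket R D).1 m)) +
      dirDeriv (gaugeAnchor m (R.1 m)) f • fiberPairing m (μ.1 m) (D.1 m)
  simp only [map_neg, map_add, map_smul]
  module

end GaugeLie

/-! ### Algebraic identities of the Dorfman bracket on all of `Γ(𝓔)`. -/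

section Dorfman

variable {n : ℕ} {M : Type*} [TopologicalSpace M]
    [ChartedSpace (EuclideanSpace ℝ (Fin n)) M] [IsManifold (𝓡 n) ∞ M]
    {F : Type*} [NormedAddCommGroup F] [NormedSpace ℝ F]
    {E : M → Type*} [TopologicalSpace (TotalSpace F E)] [∀ m, AddCommGroup (E m)]
    [∀ m, Module ℝ (E m)] [∀ m, TopologicalSpace (E m)] [FiberBundle F E] [VectorBundle ℝ F E]

lemma omniSections_ext {X Y : omniSections n F E} (h : gaugePart X = gaugePart Y)
    (h' : jetPart X = jetPart Y) : X = Y :=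
  Subtype.ext (funext fun m => Prod.ext
    (congrArg (fun D : gaugeSections n F E => D.1 m) h)
    (congrArg (fun μ : jetSections n F E => μ.1 m) h'))

lemma gaugePart_add (X Y : omniSections n F E) :
    gaugePart (X + Y) = gaugePart X + gaugePart Y := rfl

lemma jetPart_add (X Y : omniSections n F E) : jetPart (X + Y) = jetPart X + jetPart Y := rfl

lemma gaugePart_smul (r : ℝ) (X : omniSections n F E) :
    gaugePart (r • X) = r • gaugePart X := rfl

lemma jetPart_smul (r : ℝ) (X : omniSections n F E) : jetPart (r • X) = r • jetPart X := rfl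

/-- The product `f X` of a smooth function and a section of `𝓔`. -/
def omniSmul (f : SmoothFun n M) (X : omniSections n F E) : omniSections n F E :=
  ⟨fun m => f m • X.1 m, (gaugeSmul f (gaugePart X)).2, (jetSmul f (jetPart X)).2⟩

lemma gaugePart_omniSmul (f : SmoothFun n M) (X : omniSections n F E) :
    gaugePart (omniSmul f X) = gaugeSmul f (gaugePart X) := rfl

lemma jetPart_omniSmul (f : SmoothFun n M) (X : omniSections n F E) :
    jetPart (omniSmul f X) = jetSmul f (jetPart X) := rfl

variable [T2Space M] [FiniteDimensional ℝ F] [ContMDiffVectorBundle ∞ F E (𝓡 n)]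

/-- This definitional equality is the reason why `ρ` preserves brackets. -/
lemma gaugePart_dorfman (X Y : omniSections n F E) :
    gaugePart (dorfman X Y) = gaugeBracket (gaugePart X) (gaugePart Y) := rfl

lemma jetPart_dorfman (X Y : omniSections n F E) :
    jetPart (dorfman X Y) = lieDer (gaugePart X) (jetPart Y) - lieDer (gaugePart Y) (jetPart X) +
      jet (pairing (jetPart X) (gaugePart Y)) := rfl

lemma dorfman_add_left (X X' Y : omniSections n F E) :
    dorfman (X + X') Y = dorfman X Y + dorfman X' Y := by
  refine omniSections_ext (by
    simp only [gaugePart_dorfman, gaugePart_add]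
    rw [gaugeBracket_add_left]) ?_
  simp only [jetPart_add, jetPart_dorfman, gaugePart_add, lieDer_add_left, lieDer_add_right,
    pairing_add_left, jet_add]
  abel

lemma dorfman_smul_left (r : ℝ) (X Y : omniSections n F E) :
    dorfman (r • X) Y = r • dorfman X Y := by
  refine omniSections_ext (by
    simp only [gaugePart_dorfman, gaugePart_smul]
    rw [gaugeBracket_const_smul_left]) ?_
  simp only [jetPart_smul, jetPart_dorfman, gaugePart_smul, lieDer_smul_left, lieDer_smul_right,
    pairing_smul_left, jet_smul, smul_add, smul_sub]

lemma dorfman_add_right (X Y Y' : omniSections n F E) :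
    dorfman X (Y + Y') = dorfman X Y + dorfman X Y' := by
  refine omniSections_ext (by
    simp only [gaugePart_dorfman, gaugePart_add]
    rw [gaugeBracket_add_right]) ?_
  simp only [jetPart_add, jetPart_dorfman, gaugePart_add, lieDer_add_left, lieDer_add_right,
    pairing_add_right, jet_add]
  abel

lemma dorfman_smul_right (r : ℝ) (X Y : omniSections n F E) :
    dorfman X (r • Y) = r • dorfman X Y := by
  refine omniSections_ext (by
    simp only [gaugePart_dorfman, gaugePart_smul]
    rw [gaugeBracket_const_smul_right]) ?_
  simp only [jetPart_smul, jetPart_dorfman, gaugePart_smul, lieDer_smul_left, lieDer_smul_right,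
    pairing_smul_right, jet_smul, smul_add, smul_sub]

/-- The (left) Leibniz identity of the Dorfman bracket. -/
lemma dorfman_leibniz (X Y Z : omniSections n F E) :
    dorfman X (dorfman Y Z) = dorfman (dorfman X Y) Z + dorfman Y (dorfman X Z) := by
  refine omniSections_ext (by
    simp only [gaugePart_dorfman, gaugePart_add]
    rw [gaugeBracket_leibniz]) ?_
  -- Everything is expanded into iterated `𝔏`'s applied to the three jet parts and values of `𝕕`.
  -- The former match because `𝔏` is a representation. The latter match because `𝔏` commutes with
  -- `𝕕`, and because a pairing with `𝔏_D ν` or `𝔏_R μ` unfolds by the formula defining `𝔏`.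
  simp only [jetPart_add, jetPart_dorfman, gaugePart_dorfman, lieDer_add_right, lieDer_sub_right,
    lieDer_gaugeBracket, lieDer_jet, pairing_add_left, pairing_sub_left, pairing_lieDer,
    pairing_jet, jet_add, jet_sub]
  rw [gaugeBracket_swap (gaugePart Y) (gaugePart Z)]
  abel

/-- The two Lie derivatives cancel on the diagonal, so `𝕕⟨μ, 𝔡⟩_E` is the only obstruction to being
alternating. -/
lemma dorfman_self (X : omniSections n F E) (h : pairing (jetPart X) (gaugePart X) = 0) :
    dorfman X X = 0 := by
  refine omniSections_ext (gaugeBracket_self _) ?_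
  rw [jetPart_dorfman, h, sub_self, zero_add]
  exact jet_ext fun R => map_zero (gaugeOp R)

/-- The Leibniz rule of the Dorfman bracket in its second argument. -/
lemma dorfman_omniSmul (X Y : omniSections n F E) (f : SmoothFun n M) :
    dorfman X (omniSmul f Y) = omniSmul f (dorfman X Y) +
      omniSmul ((gaugeField (gaugePart X)).app f) Y := by
  refine omniSections_ext ?_ (jet_ext fun R => ?_)
  · rw [gaugePart_dorfman, gaugePart_add, gaugePart_omniSmul, gaugePart_omniSmul,
      gaugePart_omniSmul, gaugeBracket_smul_right, gaugePart_dorfman]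
  · simp only [jetPart_dorfman, jetPart_add, gaugePart_omniSmul, jetPart_omniSmul,
      lieDer_jetSmul, pairing_add_left, pairing_sub_left, pairing_jetSmul, pairing_jet,
      pairing_gaugeSmul, gaugeOp_fsmul]
    ext m
    -- With `μ` the jet part of `X`, the term `α(R)(f) ⟨μ, ρY⟩` occurs twice: negatively from `𝔏_{f
    -- ρY} μ`, and positively from `R` differentiating `f ⟨μ, ρY⟩` under `𝕕`. Only `f` and
    -- `α(ρX)(f)` survive as coefficients.
    simp only [ContMDiffSection.coe_sub, ContMDiffSection.coe_add, Pi.sub_apply, Pi.add_apply,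
      fsmul_apply, lieDer_gaugeSmul, VecField.app_apply, gaugeField_apply]
    module

end Dorfman

/-! ### Restriction to a Dirac structure. -/

section Dirac

variable {n : ℕ} {M : Type*} [TopologicalSpace M]
    [ChartedSpace (EuclideanSpace ℝ (Fin n)) M] [IsManifold (𝓡 n) ∞ M]
    {F : Type*} [NormedAddCommGroup F] [NormedSpace ℝ F]
    {E : M → Type*} [TopologicalSpace (TotalSpace F E)] [∀ m, AddCommGroup (E m)]
    [∀ m, Module ℝ (E m)] [∀ m, TopologicalSpace (E m)] [FiberBundle F E] [VectorBundle ℝ F E]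
    {L : ∀ m : M, Submodule ℝ (OmniFiber n F E m)}

/-- The inclusion `Γ(L) → Γ(𝓔)` carries the restricted bracket to the Dorfman bracket, so by
injectivity identities proved in `Γ(𝓔)` descend to `Γ(L)`. -/
lemma inclSection_injective : Function.Injective (inclSection (L := L)) := fun _ _ h =>
  Subtype.ext (funext fun m => Subtype.ext (congrFun (congrArg Subtype.val h) m))

lemma inclSection_add (s t : subSections L) :
    inclSection (s + t) = inclSection s + inclSection t := rfl

lemma inclSection_smul (r : ℝ) (s : subSections L) :
    inclSection (r • s) = r • inclSection s := rfl

variable [T2Space M] [FiniteDimensional ℝ F] [ContMDiffVectorBundle ∞ F E (𝓡 n)]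

lemma inclSection_restrictedBracket (hL : IsDirac L) (s t : subSections L) :
    inclSection (restrictedBracket hL s t) = dorfman (inclSection s) (inclSection t) := rfl

/-- On the diagonal both summands of the form equal `⟨μ, 𝔡⟩_E`, so the factor `½` makes `(X, X)_E =
⟨μ, 𝔡⟩_E`, and isotropy of the fibres applies. -/
lemma IsDirac.pairing_self (hL : IsDirac L) (s : subSections L) :
    pairing (jetPart (inclSection s)) (gaugePart (inclSection s)) = 0 := by
  ext m
  have h := (hL.maximalIsotropic m).1 _ (s.1 m).2 _ (s.1 m).2
  rw [omniPairing, ← two_smul ℝ, smul_smul] at h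
  norm_num at h
  exact h

lemma restrictedBracket_self (hL : IsDirac L) (s : subSections L) :
    restrictedBracket hL s s = 0 :=
  inclSection_injective (dorfman_self _ (hL.pairing_self s))

lemma restrictedBracket_add_left (hL : IsDirac L) (s s' t : subSections L) :
    restrictedBracket hL (s + s') t = restrictedBracket hL s t + restrictedBracket hL s' t :=
  inclSection_injective <| by
    simp only [inclSection_restrictedBracket, inclSection_add, dorfman_add_left]

lemma restrictedBracket_add_right (hL : IsDirac L) (s t t' : subSections L) :
    restrictedBracket hL s (t + t') = restrictedBracket hL s t + restrictedBracket hL s t' :=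
  inclSection_injective <| by
    simp only [inclSection_restrictedBracket, inclSection_add, dorfman_add_right]

lemma restrictedBracket_smul_left (hL : IsDirac L) (r : ℝ) (s t : subSections L) :
    restrictedBracket hL (r • s) t = r • restrictedBracket hL s t :=
  inclSection_injective <| by
    simp only [inclSection_restrictedBracket, inclSection_smul, dorfman_smul_left]

lemma restrictedBracket_smul_right (hL : IsDirac L) (r : ℝ) (s t : subSections L) :
    restrictedBracket hL s (r • t) = r • restrictedBracket hL s t :=
  inclSection_injective <| by
    simp only [inclSection_restrictedBracket, inclSection_smul, dorfman_smul_right]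

lemma restrictedBracket_swap (hL : IsDirac L) (s t : subSections L) :
    restrictedBracket hL s t = -restrictedBracket hL t s := by
  -- Polarization of the alternating property.
  have h := restrictedBracket_self hL (s + t)
  rw [restrictedBracket_add_left, restrictedBracket_add_right, restrictedBracket_add_right,
    restrictedBracket_self, restrictedBracket_self, zero_add, add_zero] at h
  exact eq_neg_of_add_eq_zero_left (G := subSections L) h

lemma restrictedBracket_leibniz (hL : IsDirac L) (s t u : subSections L) :
    restrictedBracket hL s (restrictedBracket hL t u) =
      restrictedBracket hL (restrictedBracket hL s t) u +
        restrictedBracket hL t (restrictedBracket hL s u) :=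
  inclSection_injective <| by
    simp only [inclSection_restrictedBracket, inclSection_add]
    exact dorfman_leibniz _ _ _

lemma restrictedBracket_jacobi (hL : IsDirac L) (s t u : subSections L) :
    restrictedBracket hL s (restrictedBracket hL t u) +
      restrictedBracket hL t (restrictedBracket hL u s) +
        restrictedBracket hL u (restrictedBracket hL s t) = 0 := by
  -- The derivation identity gives `[[s, t], u] + [t, [s, u]]`; the two swaps turn the other cyclic
  -- terms into the negatives of these. The sign inside `[t, -[s, u]]` is written as the scalar
  -- `-1`, to be extracted by linearity.
  rw [restrictedBracket_leibniz hL s t u, restrictedBracket_swap hL u s,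
    restrictedBracket_swap hL u (restrictedBracket hL s t), ← neg_one_smul ℝ
    (restrictedBracket hL s u), restrictedBracket_smul_right]
  module

end Dirac

end OmniLie

theorem mainTheorem5 {n : ℕ} {M : Type*} [TopologicalSpace M] [T2Space M]
    [ChartedSpace (EuclideanSpace ℝ (Fin n)) M] [IsManifold (𝓡 n) ∞ M]
    {F : Type*} [NormedAddCommGroup F] [NormedSpace ℝ F] [FiniteDimensional ℝ F]
    {E : M → Type*} [TopologicalSpace (TotalSpace F E)] [∀ m, AddCommGroup (E m)]
    [∀ m, Module ℝ (E m)] [∀ m, TopologicalSpace (E m)] [FiberBundle F E] [VectorBundle ℝ F E]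
    [ContMDiffVectorBundle ∞ F E (𝓡 n)]
    (L : ∀ m : M, Submodule ℝ (OmniLie.OmniFiber n F E m)) (hL : OmniLie.IsDirac L) :
    OmniLie.IsLieAlgebroid n (A := fun m => L m) (OmniLie.subSections L)
      (OmniLie.restrictedBracket hL)
      (fun m => (OmniLie.gaugeAnchor m).comp (OmniLie.rhoRestrict L m)) ∧
    OmniLie.IsRepresentation (A := fun m => L m) (OmniLie.subSections L)
      (OmniLie.restrictedBracket hL)
      (fun m => (OmniLie.gaugeAnchor m).comp (OmniLie.rhoRestrict L m))
      (OmniLie.rhoRestrict L) := by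
  -- Smoothness of `ρ` and of the anchor is part of membership in `Γ(𝓔)`, and compatibility with
  -- brackets is definitional. The Leibniz rule is the one field left open; it is `dorfman_omniSmul`
  -- read in the fibre over `m`.
  refine ⟨⟨hL.isSubbundle, fun s => s.2.1.1, OmniLie.restrictedBracket_add_left hL,
    OmniLie.restrictedBracket_smul_left hL, OmniLie.restrictedBracket_add_right hL,
    OmniLie.restrictedBracket_smul_right hL,
    OmniLie.restrictedBracket_self hL, OmniLie.restrictedBracket_jacobi hL, fun f s t m => ?_,
    fun _ _ _ => rfl⟩, fun s => s.2.1, fun _ _ => rfl, fun _ _ _ => rfl⟩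
  exact Subtype.ext (congrFun (congrArg Subtype.val
    (OmniLie.dorfman_omniSmul (OmniLie.inclSection s) (OmniLie.inclSection t) f)) m)

end
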